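/- Let $X$ be the closed interval $[0,1]$ or the circle $S^1=\mathbb{R}/\mathbb{Z}$, and let $\mathrm{Diff}^1_+(X)$ be the group of orientation-preserving $C^1$ diffeomorphisms of $X$. Let $\Gamma\le\mathrm{Diff}^1_+(X)$ be an almost nilpotent subgroup (that is, $\Gamma$ has a nilpotent subgroup of finite index), generated by a finite set $\mathcal{G}$. Then one of the following holds: (i) $\Gamma$ has a finite orbit in $X$ (this is always the case if $X=[0,1]$); (ii) $X=S^1$, $\Gamma$ has no finite orbit, and $\Gamma$ is topologically semiconjugate to a group of rotations: there are a homomorphism $\rho:\Gamma\to\mathbb{R}/\mathbb{Z}$ and a continuous monotone map $h:S^1\to S^1$ of degree one such that $h(f(x))=h(x)+\rho(f)$ for all $f\in\Gamma$ and $x\in S^1$. Moreover, for every $\varepsilon>0$ there exists a continuous function $u:S^1\to\mathbb{R}$ such that for every $f\in\mathcal{G}$ the inequality $|u-u\circ f-\log(Df)|\le\varepsilon$ holds everywhere on $S^1$. -/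

import Mathlib

/-! ## The closed interval `[0,1]` -/

/-- A map of `[0,1]` to itself is of class `C¹` (one-sided derivatives at the endpoints): the
real function on `[0,1]` that it defines is `C¹` on the closed interval. -/
def IsC1Interval (f : unitInterval → unitInterval) : Prop :=
  ContDiffOn ℝ 1 (Set.IccExtend zero_le_one (fun t => (f t : ℝ))) (Set.Icc (0 : ℝ) 1)

theorem IsC1Interval.comp {f g : unitInterval → unitInterval}
    (hf : IsC1Interval f) (hg : IsC1Interval g) : IsC1Interval (f ∘ g) := by
  unfold IsC1Interval at *
  refine (ContDiffOn.comp hf hg ?_).congr ?_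
  · intro t _
    exact (g (Set.projIcc 0 1 zero_le_one t)).2
  · intro t _
    simp [Set.IccExtend]

theorem isC1Interval_id : IsC1Interval id := by
  refine contDiffOn_id.congr fun t ht => ?_
  rw [Set.IccExtend_of_mem _ _ ht]
  rfl

/-- The group `Diff¹₊([0,1])` of orientation-preserving `C¹` diffeomorphisms of `[0,1]`, as a
subgroup of the group of homeomorphisms. -/
def intervalDiff : Subgroup (unitInterval ≃ₜ unitInterval) where
  carrier := {f | StrictMono f ∧ IsC1Interval f ∧ IsC1Interval f.symm}
  mul_mem' := fun {f g} hf hg => ⟨hf.1.comp hg.1, hf.2.1.comp hg.2.1, hg.2.2.comp hf.2.2⟩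
  one_mem' := ⟨strictMono_id, isC1Interval_id, isC1Interval_id⟩
  inv_mem' := fun {f} hf => by
    refine ⟨fun x y hxy => ?_, hf.2.2, hf.2.1⟩
    by_contra h
    have h1 := hf.1.monotone (not_lt.mp h)
    have h2 : ∀ z, f (f⁻¹ z) = z := fun z => f.apply_symm_apply z
    rw [h2, h2] at h1
    exact absurd hxy (not_lt.mpr h1)

/-! ## The circle `ℝ/ℤ` -/

/-- `F : ℝ → ℝ` is a (continuous) lift to the universal cover of the map `f` of the circle. -/
def IsLift (F : ℝ → ℝ) (f : UnitAddCircle → UnitAddCircle) : Prop :=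
  Continuous F ∧ ∀ t : ℝ, ((F t : ℝ) : UnitAddCircle) = f (t : UnitAddCircle)

/-- A map of the circle has a strictly increasing lift of class `C¹`. -/
def IsC1IncreasingCircle (f : UnitAddCircle → UnitAddCircle) : Prop :=
  ∃ F : ℝ → ℝ, IsLift F f ∧ StrictMono F ∧ ContDiff ℝ 1 F

theorem IsC1IncreasingCircle.comp {f g : UnitAddCircle → UnitAddCircle}
    (hf : IsC1IncreasingCircle f) (hg : IsC1IncreasingCircle g) :
    IsC1IncreasingCircle (f ∘ g) := by
  obtain ⟨F, hF, hF1, hF2⟩ := hf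
  obtain ⟨G, hG, hG1, hG2⟩ := hg
  refine ⟨F ∘ G, ⟨hF.1.comp hG.1, fun t => ?_⟩, hF1.comp hG1, hF2.comp hG2⟩
  simp [hF.2, hG.2]

theorem isC1IncreasingCircle_id : IsC1IncreasingCircle id :=
  ⟨id, ⟨continuous_id, fun _ => rfl⟩, strictMono_id, contDiff_id⟩

/-- The group `Diff¹₊(S¹)` of orientation-preserving `C¹` diffeomorphisms of the circle, as a
subgroup of the group of homeomorphisms. -/
def circleDiff : Subgroup (UnitAddCircle ≃ₜ UnitAddCircle) where
  carrier := {f | IsC1IncreasingCircle f ∧ IsC1IncreasingCircle f.symm}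
  mul_mem' := fun hf hg => ⟨hf.1.comp hg.1, hg.2.comp hf.2⟩
  one_mem' := ⟨isC1IncreasingCircle_id, isC1IncreasingCircle_id⟩
  inv_mem' := fun hf => ⟨hf.2, hf.1⟩

open Classical in
/-- The derivative `Df(x)` of a map `f` of the circle: the derivative of a lift of `f` at a
representative of `x` (see `circleDeriv_coe` for the independence of the choices); `0` if `f`
has no lift. -/
noncomputable def circleDeriv (f : UnitAddCircle → UnitAddCircle) (x : UnitAddCircle) : ℝ :=
  if h : ∃ F, IsLift F f then deriv h.choose (AddCircle.equivIco 1 0 x : ℝ) else 0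

theorem IsLift.exists_eq_add_const {F G : ℝ → ℝ} {f : UnitAddCircle → UnitAddCircle}
    (hF : IsLift F f) (hG : IsLift G f) : ∃ c : ℝ, ∀ t, F t = G t + c := by
  have hint : ∀ t, ∃ n : ℤ, (n : ℝ) = F t - G t := fun t => by
    have h : ((F t - G t : ℝ) : UnitAddCircle) = 0 := by
      rw [AddCircle.coe_sub, hF.2, hG.2, sub_self]
    obtain ⟨n, hn⟩ := (AddCircle.coe_eq_zero_iff (1 : ℝ)).1 h
    exact ⟨n, by simpa using hn⟩
  choose n hn using hint
  have hcont : Continuous n := by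
    rw [Int.isClosedEmbedding_coe_real.isEmbedding.continuous_iff]
    have : (Int.cast ∘ n : ℝ → ℝ) = fun t => F t - G t := funext hn
    rw [this]
    exact hF.1.sub hG.1
  refine ⟨n 0, fun t => ?_⟩
  rw [← PreconnectedSpace.constant inferInstance hcont (x := t) (y := 0), hn t]
  ring

theorem circleDeriv_coe {F : ℝ → ℝ} {f : UnitAddCircle → UnitAddCircle} (hF : IsLift F f)
    (t : ℝ) : circleDeriv f (t : UnitAddCircle) = deriv F t := by
  have h : ∃ F, IsLift F f := ⟨F, hF⟩
  rw [circleDeriv, dif_pos h]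
  set s : ℝ := (AddCircle.equivIco 1 0 (t : UnitAddCircle) : ℝ) with hs
  have hst : ((s - t : ℝ) : UnitAddCircle) = 0 := by
    have h1 : (s : UnitAddCircle) = t := (AddCircle.equivIco 1 0).symm_apply_apply _
    rw [AddCircle.coe_sub, h1, sub_self]
  have hlift : IsLift (fun r => F (r + (s - t))) f := by
    refine ⟨hF.1.comp (continuous_id.add continuous_const), fun r => ?_⟩
    rw [hF.2, AddCircle.coe_add, hst, add_zero]
  obtain ⟨c, hc⟩ := h.choose_spec.exists_eq_add_const hF
  obtain ⟨d, hd⟩ := hlift.exists_eq_add_const hF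
  have h1 : deriv h.choose s = deriv F s := by
    rw [show h.choose = fun r => F r + c from funext hc, deriv_add_const]
  have h2 : deriv (fun r => F (r + (s - t))) t = deriv F t := by
    rw [show (fun r => F (r + (s - t))) = fun r => F r + d from funext hd, deriv_add_const]
  rw [h1, ← h2, deriv_comp_add_const]
  congr 1
  ring

/-! ## Finite orbits and semiconjugacy to rotations -/

/-- The group `Γ` of homeomorphisms of `X` has a finite orbit. -/
def HasFiniteOrbit {X : Type*} [TopologicalSpace X] (Γ : Subgroup (X ≃ₜ X)) : Prop :=
  ∃ x : X, (Set.range fun f : Γ => (f : X ≃ₜ X) x).Finite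

/-- The group `Γ` of homeomorphisms of the circle is topologically semiconjugate to a group of
rotations: there are a homomorphism `ρ` from `Γ` to the group of rotations and a continuous
monotone map `h` of degree one of the circle such that `h ∘ f = R_{ρ(f)} ∘ h` for all `f ∈ Γ`. -/
def SemiconjToRotations (Γ : Subgroup (UnitAddCircle ≃ₜ UnitAddCircle)) : Prop :=
  ∃ (ρ : Γ →* Multiplicative UnitAddCircle) (h : UnitAddCircle → UnitAddCircle) (H : ℝ → ℝ),
    IsLift H h ∧ Monotone H ∧ (∀ t, H (t + 1) = H t + 1) ∧
    ∀ (f : Γ) (x : UnitAddCircle),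
      h ((f : UnitAddCircle ≃ₜ UnitAddCircle) x) = h x + (ρ f).toAdd

/-! On the interval the endpoint `0` is fixed. On the circle, everything rests on one fact about a
cocycle `c` over an isometric linear action of a virtually nilpotent group
(`IsometricCocycle.exists_twist_le_of_finiteIndex`): if `c` grows sublinearly along powers of the
elements of a nilpotent finite-index subgroup, then adding a coboundary makes `c` as small as
desired on any finite set. The proof climbs the upper central series. Twisting by the mean of `c(z ^
k)`, `k < N`, replaces `c z` by a vector of size `‖c(z ^ N)‖ / N`, and elsewhere costs only the
values of `c` on commutators with `z ^ k`, which lie one level lower and are already small.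

For `log Df` with the sup norm this is the statement about `u`, so sublinear growth has to be shown
(`hasSublinearPowers_logDerivCocycle`). If the rotation number is irrational, Birkhoff averages
become uniformly close to constants, and `log D(z ^ n)` has a zero. If it is rational, some power
has fixed points; nilpotency and the absence of finite orbits force derivative `1` there
(`multiplier_eq_one_of_isNilpotent`), and other points contribute little because their total
displacement is bounded.

The displacement of lifts, measured by oscillation, is a bounded cocycle. The same fact makes it
almost cohomologous to constants, so the translation number is additive, and the group of lifts is
semiconjugate to translations by a monotone `F`. If all generators have rational translation
numbers, a common denominator yields a finite orbit; otherwise `F` has dense range and is therefore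
continuous. -/

/-! ## Almost trivial cocycles over virtually nilpotent groups -/

/-- A right action of a group `G` by linear maps preserving a seminorm, together with a cocycle. -/
structure IsometricCocycle (G : Type*) [Group G] (E : Type*) [AddCommGroup E] [Module ℝ E] where
  p : Seminorm ℝ E
  R : G → E →ₗ[ℝ] E
  R_one : ∀ v, R 1 v = v
  R_mul : ∀ g h v, R (g * h) v = R h (R g v)
  p_R : ∀ g v, p (R g v) = p v
  c : G → E
  c_mul : ∀ g h, c (g * h) = R h (c g) + c h

namespace IsometricCocycle

variable {G : Type*} [Group G] {E : Type*} [AddCommGroup E] [Module ℝ E]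

theorem c_one (C : IsometricCocycle G E) : C.c 1 = 0 := by
  have h := C.c_mul 1 1
  rw [mul_one, C.R_one] at h
  simpa using h

theorem p_c_mul_le (C : IsometricCocycle G E) (g h : G) :
    C.p (C.c (g * h)) ≤ C.p (C.c g) + C.p (C.c h) := by
  rw [c_mul]
  exact (map_add_le_add _ _ _).trans_eq (by rw [C.p_R])

/-- The cocycle modified by the coboundary of `u`. -/
def twist (C : IsometricCocycle G E) (u : E) : IsometricCocycle G E where
  __ := C
  c g := C.c g + C.R g u - u
  c_mul g h := by
    simp only [map_add, map_sub, C.c_mul, C.R_mul]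
    abel

theorem twist_c (C : IsometricCocycle G E) (u : E) (g : G) :
    (C.twist u).c g = C.c g + C.R g u - u := rfl

theorem twist_twist (C : IsometricCocycle G E) (u v : E) (g : G) :
    ((C.twist u).twist v).c g = (C.twist (u + v)).c g := by
  change C.c g + C.R g u - u + C.R g v - v = C.c g + C.R g (u + v) - (u + v)
  simp only [map_add]
  abel

/-- Restriction of a cocycle along a group homomorphism. -/
def comap {H : Type*} [Group H] (C : IsometricCocycle G E) (φ : H →* G) :
    IsometricCocycle H E where
  p := C.p
  R h := C.R (φ h)
  R_one v := by rw [map_one, C.R_one]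
  R_mul g h v := by rw [map_mul, C.R_mul]
  p_R h := C.p_R (φ h)
  c h := C.c (φ h)
  c_mul g h := by rw [map_mul, C.c_mul]

/-! ### Averaging a cocycle along powers. -/

theorem p_inv_natCast_smul_sum_le (p : Seminorm ℝ E) {ι : Type*} (s : Finset ι) (f : ι → E)
    {B : ℝ} (hB : 0 ≤ B) (h : ∀ i ∈ s, p (f i) ≤ B) :
    p ((s.card : ℝ)⁻¹ • ∑ i ∈ s, f i) ≤ B := by
  rw [map_smul_eq_mul, norm_inv, Real.norm_natCast]
  have h1 : p (∑ i ∈ s, f i) ≤ s.card * B := by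
    refine (Finset.le_sum_of_subadditive p (map_zero p).le (map_add_le_add p) s f).trans ?_
    simpa using Finset.sum_le_card_nsmul s _ B h
  rcases s.eq_empty_or_nonempty with rfl | hs
  · simpa using hB
  · rw [inv_mul_le_iff₀ (by exact_mod_cast hs.card_pos)]
    exact h1

/-- The mean of the values of a cocycle along the first `N` powers of `z`. -/
noncomputable def powMean (C : IsometricCocycle G E) (z : G) (N : ℕ) : E :=
  (N : ℝ)⁻¹ • ∑ k ∈ Finset.range N, C.c (z ^ k)

theorem twist_powMean (C : IsometricCocycle G E) (z : G) {N : ℕ} (hN : 0 < N) (g : G) :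
    (C.twist (C.powMean z N)).c g =
      (N : ℝ)⁻¹ • ∑ k ∈ Finset.range N, (C.c (z ^ k * g) - C.c (z ^ k)) := by
  have hN' : (N : ℝ) ≠ 0 := by exact_mod_cast hN.ne'
  have h : C.c g = (N : ℝ)⁻¹ • ∑ _k ∈ Finset.range N, C.c g := by
    rw [Finset.sum_const, Finset.card_range, ← Nat.cast_smul_eq_nsmul ℝ, smul_smul,
      inv_mul_cancel₀ hN', one_smul]
  rw [twist_c, powMean, h, map_smul, map_sum, ← smul_add, ← smul_sub, ← Finset.sum_add_distrib,
    ← Finset.sum_sub_distrib]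
  congr 1
  refine Finset.sum_congr rfl fun k _ => ?_
  rw [C.c_mul]
  abel

/-- For `g = z` the mean of differences telescopes. -/
theorem p_twist_powMean_self (C : IsometricCocycle G E) (z : G) {N : ℕ} (hN : 0 < N) :
    C.p ((C.twist (C.powMean z N)).c z) = (N : ℝ)⁻¹ * C.p (C.c (z ^ N)) := by
  rw [C.twist_powMean z hN]
  simp_rw [← pow_succ]
  rw [Finset.sum_range_sub (fun k => C.c (z ^ k)), pow_zero, c_one, sub_zero, map_smul_eq_mul,
    norm_inv, Real.norm_natCast]

/-- Moving `z ^ k` past `g` costs the commutator `g⁻¹ * z ^ k * g * (z ^ k)⁻¹`; the remaining factor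
`z ^ k` on the right acts isometrically and its cocycle value cancels. -/
theorem p_twist_powMean_le (C : IsometricCocycle G E) (z : G) {N : ℕ} (hN : 0 < N) (g : G)
    {ε : ℝ} (hε : 0 ≤ ε) (h : ∀ k < N, C.p (C.c (g⁻¹ * z ^ k * g * (z ^ k)⁻¹)) ≤ ε) :
    C.p ((C.twist (C.powMean z N)).c g) ≤ C.p (C.c g) + ε := by
  rw [C.twist_powMean z hN]
  have := p_inv_natCast_smul_sum_le C.p (Finset.range N)
    (fun k => C.c (z ^ k * g) - C.c (z ^ k)) (B := C.p (C.c g) + ε)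
    (add_nonneg (apply_nonneg _ _) hε) ?_
  · rwa [Finset.card_range] at this
  · intro k hk
    have e : z ^ k * g = (g * (g⁻¹ * z ^ k * g * (z ^ k)⁻¹)) * z ^ k := by group
    rw [e, C.c_mul, add_sub_cancel_right, C.p_R]
    exact (C.p_c_mul_le _ _).trans (by gcongr; exact h k (Finset.mem_range.1 hk))

/-- On finite subsets of `A` the cocycle can be made small by adding a coboundary, with almost no
growth at finitely many other elements of the group. -/
def IsReducibleOn (C : IsometricCocycle G E) (A : Set G) : Prop :=
  ∀ S T : Finset G, (S : Set G) ⊆ A → ∀ ε : ℝ, 0 < ε → ∃ u : E,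
    (∀ s ∈ S, C.p ((C.twist u).c s) ≤ ε) ∧ ∀ t ∈ T, C.p ((C.twist u).c t) ≤ C.p (C.c t) + ε

/-- The cocycle grows sublinearly along some subsequence of the powers of each element. -/
def HasSublinearPowers (C : IsometricCocycle G E) : Prop :=
  ∀ g : G, ∀ ε : ℝ, 0 < ε → ∃ n : ℕ, 0 < n ∧ C.p (C.c (g ^ n)) ≤ ε * n

open Classical in
theorem IsReducibleOn.insert {C : IsometricCocycle G E} {A : Set G} (hA : C.IsReducibleOn A)
    (hC : C.HasSublinearPowers) {z : G}
    (hz : ∀ (k : ℕ) (g : G), g⁻¹ * z ^ k * g * (z ^ k)⁻¹ ∈ A) :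
    C.IsReducibleOn (insert z A) := by
  intro S T hS ε hε
  -- `N` is fixed before `u`, because the commutators to be made small depend on it. Including `z ^
  -- N` among the elements without growth preserves its sublinear bound after the twist by `u`.
  obtain ⟨N, hN, hNz⟩ := hC z (ε / 2) (half_pos hε)
  obtain ⟨u, hu1, hu2⟩ := hA
    (S.erase z ∪ (S ∪ T).biUnion fun g =>
      (Finset.range N).image fun k => g⁻¹ * z ^ k * g * (z ^ k)⁻¹)
    (T ∪ {z ^ N}) (by
      intro s hs
      simp only [Finset.coe_union, Set.mem_union, Finset.mem_coe, Finset.mem_erase,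
        Finset.mem_biUnion, Finset.mem_image] at hs
      rcases hs with ⟨h1, h2⟩ | ⟨g, -, k, -, rfl⟩
      · exact (hS h2).resolve_left h1
      · exact hz k g) (ε / 2) (half_pos hε)
  have hw : ∀ g ∈ S ∪ T, ∀ k < N,
      C.p ((C.twist u).c (g⁻¹ * z ^ k * g * (z ^ k)⁻¹)) ≤ ε / 2 := fun g hg k hk =>
    hu1 _ (Finset.mem_union_right _ (Finset.mem_biUnion.2
      ⟨g, hg, Finset.mem_image.2 ⟨k, Finset.mem_range.2 hk, rfl⟩⟩))
  have key : ∀ g ∈ S ∪ T, C.p ((C.twist (u + (C.twist u).powMean z N)).c g) ≤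
      C.p ((C.twist u).c g) + ε / 2 := fun g hg => by
    rw [← twist_twist]
    exact (C.twist u).p_twist_powMean_le z hN g (half_pos hε).le (hw g hg)
  refine ⟨u + (C.twist u).powMean z N, fun s hs => ?_, fun t ht => ?_⟩
  · rcases eq_or_ne s z with rfl | hsz
    · rw [← twist_twist]
      refine ((C.twist u).p_twist_powMean_self s hN).trans_le ?_
      have h1 := hu2 (s ^ N) (by simp)
      have hN1 : (1 : ℝ) ≤ N := by exact_mod_cast hN
      rw [inv_mul_le_iff₀ (by positivity)]
      change C.p ((C.twist u).c (s ^ N)) ≤ _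
      nlinarith
    · have h1 := key s (Finset.mem_union_left _ hs)
      have h2 := hu1 s (Finset.mem_union_left _ (Finset.mem_erase.2 ⟨hsz, hs⟩))
      linarith
  · have h1 := key t (Finset.mem_union_right _ ht)
    have h2 := hu2 t (Finset.mem_union_left _ ht)
    linarith

theorem isReducibleOn_upperCentralSeries (C : IsometricCocycle G E) (hC : C.HasSublinearPowers)
    (n : ℕ) : C.IsReducibleOn (Subgroup.upperCentralSeries G n : Set G) := by
  induction n with
  | zero =>
    intro S T hS ε hε
    refine ⟨0, fun s hs => ?_, fun t _ => ?_⟩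
    · have h : s = 1 := by simpa using hS hs
      rw [h, c_one, map_zero]
      exact hε.le
    · simpa [twist_c] using hε.le
  | succ n ih =>
    -- Elements of the next level are adjoined one at a time; their commutators always fall into
    -- level `n`, which stays in the set throughout.
    have key : ∀ F : Finset G, (F : Set G) ⊆ Subgroup.upperCentralSeries G (n + 1) →
        C.IsReducibleOn (F ∪ (Subgroup.upperCentralSeries G n : Set G)) := by
      classical
      intro F
      induction F using Finset.induction_on with
      | empty => intro _; simpa using ih
      | insert z F _ hF =>
        intro h
        rw [Finset.coe_insert, Set.insert_subset_iff] at h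
        rw [Finset.coe_insert, Set.insert_union]
        refine (hF h.2).insert hC fun k g => Or.inr ?_
        have h1 := inv_mem (Subgroup.mem_upperCentralSeries_succ_iff.1 (pow_mem h.1 k) g⁻¹)
        rw [commutatorElement_def] at h1
        have e : (z ^ k * g⁻¹ * (z ^ k)⁻¹ * g⁻¹⁻¹)⁻¹ = g⁻¹ * z ^ k * g * (z ^ k)⁻¹ := by group
        rwa [e] at h1
    exact fun S T hS => key S hS S T Set.subset_union_left

theorem isReducibleOn_univ_of_isNilpotent [Group.IsNilpotent G] (C : IsometricCocycle G E)
    (hC : C.HasSublinearPowers) : C.IsReducibleOn Set.univ := by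
  obtain ⟨n, hn⟩ := Group.IsNilpotent.nilpotent G
  have := C.isReducibleOn_upperCentralSeries hC n
  rwa [hn, Subgroup.coe_top] at this

open Classical in
/-- A cocycle over a virtually nilpotent group that grows sublinearly along powers is a limit of
coboundaries. -/
theorem exists_twist_le_of_finiteIndex (C : IsometricCocycle G E) (H : Subgroup G)
    [H.FiniteIndex] [Group.IsNilpotent H] (hC : (C.comap H.subtype).HasSublinearPowers)
    (S : Finset G) {ε : ℝ} (hε : 0 < ε) :
    ∃ u : E, ∀ s ∈ S, C.p ((C.twist u).c s) ≤ ε := by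
  have : Fintype (G ⧸ H) := H.fintypeQuotientOfFiniteIndex
  have hmem : ∀ (g : G) (q : G ⧸ H), (q.out⁻¹ * g) * ((g⁻¹ • q).out) ∈ H := fun g q => by
    have h1 : (((g⁻¹ • q).out : G) : G ⧸ H) = ((g⁻¹ * q.out : G) : G ⧸ H) := by
      rw [QuotientGroup.out_eq', ← smul_eq_mul, ← MulAction.Quotient.smul_coe,
        QuotientGroup.out_eq']
    have h2 := QuotientGroup.eq.1 h1.symm
    simpa [mul_assoc] using h2
  obtain ⟨u, hu, -⟩ := (C.comap H.subtype).isReducibleOn_univ_of_isNilpotent hC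
    (S.biUnion fun g => Finset.univ.image fun q : G ⧸ H => ⟨_, hmem g q⟩) ∅
    (Set.subset_univ _) ε hε
  -- With `b x = c x + R x u`, left multiplication by `h ∈ H` changes `b` by a vector of the size of
  -- the twisted `c h`, hence little for the finitely many `h` needed. So `b` is almost a function
  -- on right cosets of `H`, and its mean over representatives `q.out⁻¹` is the sought vector.
  obtain ⟨b, hb1, hb2⟩ : ∃ b : G → E, (∀ h r, b (h * r) = C.R r ((C.twist u).c h) + b r) ∧
      ∀ x g, b (x * g) = C.c g + C.R g (b x) := by
    refine ⟨fun x => C.c x + C.R x u, fun h r => ?_, fun x g => ?_⟩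
    · simp only [twist_c, C.c_mul, C.R_mul, map_add, map_sub]
      abel
    · simp only [C.c_mul, C.R_mul, map_add]
      abel
  set m : ℝ := ((Finset.univ : Finset (G ⧸ H)).card : ℝ) with hm
  have hm0 : m ≠ 0 := by
    rw [hm]
    exact_mod_cast (Finset.card_pos.2 ⟨((1 : G) : G ⧸ H), Finset.mem_univ _⟩).ne'
  refine ⟨m⁻¹ • ∑ q : G ⧸ H, b (q.out⁻¹), fun g hg => ?_⟩
  have e1 : (C.twist (m⁻¹ • ∑ q : G ⧸ H, b (q.out⁻¹))).c g =
      m⁻¹ • ∑ q : G ⧸ H, (b (q.out⁻¹ * g) - b ((g⁻¹ • q).out⁻¹)) := by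
    have h1 : ∑ q : G ⧸ H, b ((g⁻¹ • q).out⁻¹) = ∑ q : G ⧸ H, b (q.out⁻¹) :=
      Equiv.sum_comp (MulAction.toPerm g⁻¹) fun q : G ⧸ H => b (q.out⁻¹)
    have h2 : C.c g = m⁻¹ • ∑ _q : G ⧸ H, C.c g := by
      rw [Finset.sum_const, ← Nat.cast_smul_eq_nsmul ℝ, smul_smul, inv_mul_cancel₀ hm0, one_smul]
    have h3 : ∑ q : G ⧸ H, b (q.out⁻¹ * g) =
        ∑ _q : G ⧸ H, C.c g + ∑ q : G ⧸ H, C.R g (b q.out⁻¹) := by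
      rw [← Finset.sum_add_distrib]
      exact Finset.sum_congr rfl fun q _ => hb2 _ _
    rw [Finset.sum_sub_distrib, h1, h3, twist_c, map_smul, map_sum, smul_sub, smul_add, ← h2]
  rw [e1]
  refine p_inv_natCast_smul_sum_le C.p Finset.univ _ hε.le fun q _ => ?_
  -- Right translation by `g` permutes the right cosets; the two representatives differ by the
  -- element of `H` from `hmem`.
  have e2 : q.out⁻¹ * g = ((q.out⁻¹ * g) * (g⁻¹ • q).out) * (g⁻¹ • q).out⁻¹ := by group
  rw [e2, hb1, add_sub_cancel_right, C.p_R]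
  exact hu ⟨_, hmem g q⟩ (Finset.mem_biUnion.2
    ⟨g, hg, Finset.mem_image.2 ⟨q, Finset.mem_univ _, rfl⟩⟩)

end IsometricCocycle

/-! ## Circle diffeomorphisms: lifts and derivatives -/

theorem UnitAddCircle.coe_eq_coe_iff {s t : ℝ} :
    (s : UnitAddCircle) = t ↔ ∃ n : ℤ, s = t + n := by
  rw [← sub_eq_zero, ← AddCircle.coe_sub, AddCircle.coe_eq_zero_iff]
  simp only [zsmul_eq_mul, mul_one, eq_sub_iff_add_eq]
  exact exists_congr fun n => ⟨fun h => by rw [← h, add_comm], fun h => by rw [h, add_comm]⟩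

theorem UnitAddCircle.coe_add_one (t : ℝ) : ((t + 1 : ℝ) : UnitAddCircle) = t :=
  UnitAddCircle.coe_eq_coe_iff.2 ⟨1, by simp⟩

theorem UnitAddCircle.continuous_of_comp_coe {Y : Type*} [TopologicalSpace Y]
    {f : UnitAddCircle → Y} (h : Continuous fun t : ℝ => f t) : Continuous f :=
  (QuotientAddGroup.isQuotientMap_mk _).continuous_iff.2 h

theorem IsLift.comp {F G : ℝ → ℝ} {f g : UnitAddCircle → UnitAddCircle}
    (hF : IsLift F f) (hG : IsLift G g) : IsLift (F ∘ G) (f ∘ g) :=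
  ⟨hF.1.comp hG.1, fun t => by simp [hF.2, hG.2]⟩

theorem IsLift.add_intCast {F : ℝ → ℝ} {f : UnitAddCircle → UnitAddCircle} (hF : IsLift F f)
    (n : ℤ) : IsLift (fun t => F t + n) f :=
  ⟨hF.1.add continuous_const, fun t => by
    rw [← hF.2]; exact UnitAddCircle.coe_eq_coe_iff.2 ⟨n, rfl⟩⟩

/-- The increment over a period is a positive integer, so the value `F t + 1` is taken at some `s ∈
[t, t + 1]`. Injectivity of `f` makes `s - t` an integer, and it can only be `1`. -/
theorem IsLift.map_add_one {F : ℝ → ℝ} {f : UnitAddCircle → UnitAddCircle} (hF : IsLift F f)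
    (hmono : StrictMono F) (hf : Function.Injective f) (t : ℝ) : F (t + 1) = F t + 1 := by
  obtain ⟨n, hn⟩ : ∃ n : ℤ, F (t + 1) = F t + n := by
    rw [← UnitAddCircle.coe_eq_coe_iff, hF.2, hF.2, UnitAddCircle.coe_add_one]
  have hn0 : 0 < n := by
    have : F t < F (t + 1) := hmono (lt_add_one t)
    rw [hn] at this
    exact_mod_cast (lt_add_iff_pos_right _).1 this
  have hn1 : (1 : ℝ) ≤ n := by exact_mod_cast hn0
  obtain ⟨s, ⟨hs1, hs2⟩, hs⟩ := intermediate_value_Icc (lt_add_one t).le hF.1.continuousOn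
    (show F t + 1 ∈ Set.Icc (F t) (F (t + 1)) from ⟨by linarith, by linarith⟩)
  have hst : (s : UnitAddCircle) = t := hf (by
    rw [← hF.2, ← hF.2]; exact UnitAddCircle.coe_eq_coe_iff.2 ⟨1, by simp [hs]⟩)
  obtain ⟨m, rfl⟩ := UnitAddCircle.coe_eq_coe_iff.1 hst
  have hm1 : m ≤ 1 := by
    have : (m : ℝ) ≤ 1 := by linarith
    exact_mod_cast this
  have hm0 : 0 < m := by
    have : t < t + m := hmono.lt_iff_lt.1 (by linarith)
    have : (0 : ℝ) < m := by linarith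
    exact_mod_cast this
  obtain rfl : m = 1 := by omega
  rw [← hs]
  simp

/-- A circle diffeomorphism has a `C¹` lift which is an invertible lift of degree one. -/
theorem exists_units_isLift {g : UnitAddCircle ≃ₜ UnitAddCircle} (hg : g ∈ circleDiff) :
    ∃ u : CircleDeg1Liftˣ, IsLift u g ∧ ContDiff ℝ 1 u := by
  obtain ⟨⟨F, hF, hFm, hFs⟩, F', hF', -, -⟩ := hg
  set U : CircleDeg1Lift := ⟨⟨F, hFm.monotone⟩, hF.map_add_one hFm g.injective⟩ with hU
  have hUF : ∀ t, U t = F t := fun _ => rfl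
  have hbij : Function.Bijective U := by
    refine ⟨hFm.injective, fun t => ?_⟩
    -- `F ∘ F'` lifts the identity, so `F' t` is a preimage of `t` up to an integer.
    have h : (t : UnitAddCircle) = (F (F' t) : ℝ) := by
      rw [hF.2, hF'.2]
      exact (g.apply_symm_apply _).symm
    obtain ⟨n, hn⟩ := UnitAddCircle.coe_eq_coe_iff.1 h
    exact ⟨F' t + n, by rw [CircleDeg1Lift.map_add_int, hUF, ← hn]⟩
  obtain ⟨u, hu⟩ := CircleDeg1Lift.isUnit_iff_bijective.2 hbij
  exact ⟨u, by rw [hu]; exact hF, by rw [hu]; exact hFs⟩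

theorem IsLift.inv {u : CircleDeg1Liftˣ} {g : UnitAddCircle ≃ₜ UnitAddCircle} (h : IsLift u g) :
    IsLift (u⁻¹ : CircleDeg1Liftˣ) g.symm := by
  refine ⟨?_, fun t => ?_⟩
  · exact (CircleDeg1Lift.toOrderIso u).symm.continuous
  · rw [Homeomorph.eq_symm_apply, ← h.2, CircleDeg1Lift.units_apply_inv_apply]

theorem circleDeriv_mul {g h : UnitAddCircle ≃ₜ UnitAddCircle} (hg : g ∈ circleDiff)
    (hh : h ∈ circleDiff) (x : UnitAddCircle) :
    circleDeriv (g * h : UnitAddCircle ≃ₜ UnitAddCircle) x =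
      circleDeriv g (h x) * circleDeriv h x := by
  obtain ⟨G, hG, -, hGs⟩ := hg.1
  obtain ⟨H, hH, -, hHs⟩ := hh.1
  induction x using QuotientAddGroup.induction_on with
  | H t =>
    change circleDeriv (g ∘ h) (t : UnitAddCircle) = circleDeriv g (h (t : UnitAddCircle)) * _
    rw [circleDeriv_coe (hG.comp hH), ← hH.2, circleDeriv_coe hG]
    erw [circleDeriv_coe hH]
    exact deriv_comp t (hGs.differentiable one_ne_zero _) (hHs.differentiable one_ne_zero _)

theorem circleDeriv_one (x : UnitAddCircle) :
    circleDeriv (1 : UnitAddCircle ≃ₜ UnitAddCircle) x = 1 := by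
  induction x using QuotientAddGroup.induction_on with
  | H t =>
    have h : IsLift id (1 : UnitAddCircle ≃ₜ UnitAddCircle) := ⟨continuous_id, fun _ => rfl⟩
    exact (circleDeriv_coe h t).trans (deriv_id t)

/-- The chain rule for `g⁻¹ * g` excludes the value zero, and an increasing lift excludes negative
values. -/
theorem circleDeriv_pos {g : UnitAddCircle ≃ₜ UnitAddCircle} (hg : g ∈ circleDiff)
    (x : UnitAddCircle) : 0 < circleDeriv g x := by
  have h := circleDeriv_mul (inv_mem hg) hg x
  rw [inv_mul_cancel, circleDeriv_one] at h
  refine lt_of_le_of_ne ?_ fun h0 => by simp [← h0] at h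
  obtain ⟨G, hG, hGm, -⟩ := hg.1
  induction x using QuotientAddGroup.induction_on with
  | H t =>
    change 0 ≤ circleDeriv g (t : UnitAddCircle)
    rw [circleDeriv_coe hG]
    exact hGm.monotone.deriv_nonneg

theorem continuous_circleDeriv {g : UnitAddCircle ≃ₜ UnitAddCircle} (hg : g ∈ circleDiff) :
    Continuous (circleDeriv g) := by
  obtain ⟨G, hG, -, hGs⟩ := hg.1
  apply UnitAddCircle.continuous_of_comp_coe
  simp_rw [circleDeriv_coe hG]
  exact hGs.continuous_deriv le_rfl

/-- The logarithm of the derivative of a circle diffeomorphism. -/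
noncomputable def circleLogDeriv (g : circleDiff) : C(UnitAddCircle, ℝ) where
  toFun x := Real.log (circleDeriv (g : UnitAddCircle ≃ₜ UnitAddCircle) x)
  continuous_toFun := (continuous_circleDeriv g.2).log fun x => (circleDeriv_pos g.2 x).ne'

/-- The logarithm of the derivative as a cocycle with values in the continuous functions. -/
noncomputable def logDerivCocycle : IsometricCocycle circleDiff C(UnitAddCircle, ℝ) where
  p := normSeminorm ℝ _
  R g :=
    { toFun := fun v => v.comp ⟨g.1, g.1.continuous⟩
      map_add' := fun _ _ => rfl
      map_smul' := fun _ _ => rfl }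
  R_one v := rfl
  R_mul g h v := rfl
  p_R g v := by
    change ‖v.comp ⟨g.1, g.1.continuous⟩‖ = ‖v‖
    refine le_antisymm ?_ ?_
    · exact (ContinuousMap.norm_le _ (norm_nonneg _)).2 fun x => v.norm_coe_le_norm _
    · refine (ContinuousMap.norm_le _ (norm_nonneg _)).2 fun x => ?_
      have h := (v.comp ⟨g.1, g.1.continuous⟩).norm_coe_le_norm (g.1.symm x)
      simpa using h
  c := circleLogDeriv
  c_mul g h := by
    ext x
    change Real.log (circleDeriv (g.1 * h.1 : UnitAddCircle ≃ₜ UnitAddCircle) x) = _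
    rw [circleDeriv_mul g.2 h.2, Real.log_mul (circleDeriv_pos g.2 _).ne'
      (circleDeriv_pos h.2 _).ne']
    rfl

open Filter Topology in
/-- If a circle diffeomorphism has infinitely many fixed points with the same derivative, then
this derivative is `1`. -/
theorem eq_one_of_infinite_fixedPoints {g : UnitAddCircle ≃ₜ UnitAddCircle}
    (hg : g ∈ circleDiff) {lam : ℝ}
    (h : {x : UnitAddCircle | g x = x ∧ circleDeriv g x = lam}.Infinite) : lam = 1 := by
  obtain ⟨G, hG, -, hGs⟩ := hg.1
  have hGd : Continuous (deriv G) := hGs.continuous_deriv le_rfl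
  -- The zeros of `ψ` are the points with `G s - s` an integer, that is, the lifts of fixed points,
  -- so a single function detects them whatever the integer. At an accumulation point its derivative
  -- is `± π (lam - 1)`; if this were nonzero the zero would be isolated.
  set ψ : ℝ → ℝ := fun s => Real.sin (Real.pi * (G s - s)) with hψ
  have hψc : Continuous ψ := Real.continuous_sin.comp
    (continuous_const.mul (hG.1.sub continuous_id))
  set T : Set ℝ := {s | s ∈ Set.Icc (0 : ℝ) 1 ∧ ψ s = 0 ∧ deriv G s = lam} with hT
  have hTinf : T.Infinite := by
    refine Set.Infinite.of_image (fun s : ℝ => (s : UnitAddCircle)) (h.mono ?_)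
    rintro x ⟨hx1, hx2⟩
    obtain ⟨s, hs, rfl⟩ := AddCircle.eq_coe_Ico (p := (1 : ℝ)) x
    obtain ⟨n, hn⟩ := UnitAddCircle.coe_eq_coe_iff.1 ((hG.2 s).trans hx1)
    refine ⟨s, ⟨⟨hs.1, hs.2.le⟩, ?_, ?_⟩, rfl⟩
    · rw [hψ]
      simp only [hn, add_sub_cancel_left]
      rw [mul_comm]
      exact Real.sin_int_mul_pi n
    · rw [← circleDeriv_coe hG]
      exact hx2
  obtain ⟨t, -, ht⟩ := hTinf.exists_accPt_of_subset_isCompact isCompact_Icc fun s hs => hs.1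
  have hTc : IsClosed T := isClosed_Icc.inter
    ((isClosed_eq hψc continuous_const).inter (isClosed_eq hGd continuous_const))
  have htT : t ∈ T := hTc.closure_subset_iff.2 subset_rfl (mem_closure_iff_clusterPt.2 ht.clusterPt)
  rw [accPt_iff_frequently_nhdsNE] at ht
  have hder : HasDerivAt ψ (Real.cos (Real.pi * (G t - t)) * (Real.pi * (deriv G t - 1))) t :=
    ((((hGs.differentiable one_ne_zero t).hasDerivAt).sub (hasDerivAt_id t)).const_mul
      Real.pi).sin
  by_contra hne
  refine ht ((hder.eventually_ne (c := 0) ?_).mono fun s hs hsT => hs hsT.2.1)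
  rw [htT.2.2]
  refine mul_ne_zero (fun hcos => ?_) (mul_ne_zero Real.pi_ne_zero (sub_ne_zero.2 hne))
  have h1 := Real.sin_sq_add_cos_sq (Real.pi * (G t - t))
  rw [hcos, show Real.sin (Real.pi * (G t - t)) = 0 from htT.2.1] at h1
  norm_num at h1

/-! ## Multipliers of fixed points in nilpotent groups -/

theorem exists_pow_smul_eq_of_forall_mem {G X : Type*} [Group G] [MulAction G X] {z : G} {q : X}
    {O : Set X} (hO : O.Finite) (h : ∀ n : ℕ, (z ^ n)⁻¹ • q ∈ O) :
    ∃ d : ℕ, 0 < d ∧ d ≤ O.ncard ∧ z ^ d • q = q := by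
  obtain ⟨i, hi, j, hj, hij, he⟩ := Finset.exists_ne_map_eq_of_card_lt_of_maps_to
    (s := Finset.range (O.ncard + 1)) (t := hO.toFinset) (f := fun n => (z ^ n)⁻¹ • q)
    (by rw [Finset.card_range, Set.ncard_eq_toFinset_card O hO]; exact Nat.lt_succ_self _)
    (fun n _ => by simpa using h n)
  wlog hlt : i < j generalizing i j
  · exact this j hj i hi hij.symm he.symm (by omega)
  refine ⟨j - i, by omega, ?_, ?_⟩
  · have := Finset.mem_range.1 hj
    omega
  · have e : z ^ (j - i) = z ^ j * (z ^ i)⁻¹ := by rw [pow_sub z hlt.le]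
    have he' : (z ^ i)⁻¹ • q = (z ^ j)⁻¹ • q := he
    rw [e, mul_smul, he', smul_inv_smul]

/-- Let a nilpotent group act with infinite orbits, and let `D` be a positive multiplicative
cocycle such that an element cannot have infinitely many fixed points with the same multiplier
other than `1`. Then all multipliers are `1`. -/
theorem multiplier_eq_one_of_isNilpotent {N X : Type*} [Group N] [Group.IsNilpotent N]
    [MulAction N X] (D : N → X → ℝ) (hD : ∀ g h x, D (g * h) x = D g (h • x) * D h x)
    (hpos : ∀ g x, 0 < D g x)
    (hacc : ∀ (g : N) (lam : ℝ), {x | g • x = x ∧ D g x = lam}.Infinite → lam = 1)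
    (horb : ∀ x : X, (MulAction.orbit N x).Infinite) (z : N) (p : X) (hz : z • p = p) :
    D z p = 1 := by
  classical
  have hD1 : ∀ x, D 1 x = 1 := fun x => by
    have h := hD 1 1 x
    rw [mul_one, one_smul] at h
    exact (mul_eq_left₀ (hpos 1 x).ne').1 h.symm
  have hDpow : ∀ (g : N) (x : X), g • x = x → ∀ n : ℕ, D (g ^ n) x = D g x ^ n := by
    intro g x hg n
    induction n with
    | zero => simp [hD1]
    | succ n ih => rw [pow_succ, hD, hg, ih, pow_succ]
  by_contra hne
  -- `i` will be the lowest level of the upper central series that contains an element with a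
  -- nontrivial multiplier.
  have hex : ∃ i, ∃ z ∈ Subgroup.upperCentralSeries N i, ∃ p : X, z • p = p ∧ D z p ≠ 1 := by
    obtain ⟨n, hn⟩ := Group.IsNilpotent.nilpotent N
    exact ⟨n, z, by rw [hn]; trivial, p, hz, hne⟩
  clear hne hz p z
  set i := Nat.find hex with hi
  obtain ⟨z, hzi, p, hzp, hne⟩ := Nat.find_spec hex
  have hmin : ∀ k < i, ∀ v ∈ Subgroup.upperCentralSeries N k, ∀ q : X, v • q = q → D v q = 1 := by
    intro k hk v hv q hq
    by_contra h
    exact Nat.find_min hex hk ⟨v, hv, q, hq, h⟩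
  -- `j` will be the lowest level under which `p` has an infinite orbit.
  have hex' : ∃ j, {x | ∃ w ∈ Subgroup.upperCentralSeries N j, w • p = x}.Infinite := by
    obtain ⟨n, hn⟩ := Group.IsNilpotent.nilpotent N
    refine ⟨n, (horb p).mono ?_⟩
    rintro _ ⟨w, rfl⟩
    exact ⟨w, by rw [hn]; trivial, rfl⟩
  set j := Nat.find hex' with hj
  have hjinf := Nat.find_spec hex'
  have hi0 : i ≠ 0 := by
    intro h0
    rw [← hi, h0, Subgroup.upperCentralSeries_zero, Subgroup.mem_bot] at hzi
    exact hne (by rw [hzi, hD1])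
  have hj0 : j ≠ 0 := by
    intro h0
    rw [← hj, h0] at hjinf
    refine hjinf ((Set.finite_singleton p).subset ?_)
    rintro _ ⟨w, hw, rfl⟩
    rw [Subgroup.upperCentralSeries_zero, Subgroup.mem_bot] at hw
    simp [hw]
  -- Level `k` lies below both: its multipliers are trivial, its orbit `O` of `p` is finite, and it
  -- contains the commutators of `z` with level `j`.
  set k := min i j - 1 with hk
  have hki : k < i := by omega
  have hkj : k < j := by omega
  have hfin : {x | ∃ w ∈ Subgroup.upperCentralSeries N k, w • p = x}.Finite :=
    Set.not_infinite.1 (Nat.find_min hex' hkj)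
  set O := {x | ∃ w ∈ Subgroup.upperCentralSeries N k, w • p = x} with hO
  set M := O.ncard.factorial with hM
  have hM0 : M ≠ 0 := Nat.factorial_ne_zero _
  have hcomm : ∀ w ∈ Subgroup.upperCentralSeries N j,
      z⁻¹ * w * z * w⁻¹ ∈ Subgroup.upperCentralSeries N k := by
    intro w hw
    rcases le_total i j with h | h
    · have e : i = k + 1 := by omega
      rw [← hi, e] at hzi
      have := Subgroup.mem_upperCentralSeries_succ_iff.1 (inv_mem hzi) w
      rwa [commutatorElement_def, inv_inv] at this
    · have e : j = k + 1 := by omega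
      rw [e] at hw
      have := inv_mem (Subgroup.mem_upperCentralSeries_succ_iff.1 hw z⁻¹)
      rw [commutatorElement_def] at this
      convert this using 1
      group
  -- The power `M = |O|!` works for all `w` at once, so `z ^ M` has infinitely many fixed points
  -- with the same multiplier, and the accumulation hypothesis applies.
  have key : ∀ w ∈ Subgroup.upperCentralSeries N j,
      z ^ M • w • p = w • p ∧ D (z ^ M) (w • p) = D z p ^ M := by
    intro w hw
    set v := z⁻¹ * w * z * w⁻¹ with hv
    have hvk := hcomm w hw
    have hzv : z * v = w * z * w⁻¹ := by rw [hv]; group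
    have hfix : ∀ n : ℕ, (z * v) ^ n • w • p = w • p := by
      intro n
      rw [hzv, conj_pow, mul_smul, inv_smul_smul, mul_smul]
      congr 1
      exact MulAction.mem_stabilizer_iff.1 (pow_mem (MulAction.mem_stabilizer_iff.2 hzp) n)
    -- The conjugate `z * v = w * z * w⁻¹` fixes `w • p`, and its powers agree with those of `z`
    -- modulo level `k`. Hence `(z ^ n)⁻¹` moves `w • p` only within `w • O`, and pigeonhole gives a
    -- period of `w • p` under `z` that is at most `|O|`.
    have hvn : ∀ n : ℕ, (z ^ n)⁻¹ * (z * v) ^ n ∈ Subgroup.upperCentralSeries N k := by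
      intro n
      induction n with
      | zero => simp
      | succ n ih =>
        have e : (z ^ (n + 1))⁻¹ * (z * v) ^ (n + 1) =
            (z⁻¹ * ((z ^ n)⁻¹ * (z * v) ^ n) * z⁻¹⁻¹) * v := by
          rw [pow_succ z n, pow_succ (z * v) n]
          group
        rw [e]
        exact mul_mem (Subgroup.Normal.conj_mem inferInstance _ ih _) hvk
    have hvq : ∀ n : ℕ, ((z ^ n)⁻¹ * (z * v) ^ n) • w • p = (z ^ n)⁻¹ • w • p := fun n => by
      rw [mul_smul, hfix]
    obtain ⟨d, hd0, hd, hdq⟩ : ∃ d : ℕ, 0 < d ∧ d ≤ O.ncard ∧ z ^ d • w • p = w • p := by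
      have := exists_pow_smul_eq_of_forall_mem (z := z) (q := w • p) (hfin.image (w • ·))
        (fun n => by
          rw [← hvq]
          refine ⟨(w⁻¹ * ((z ^ n)⁻¹ * (z * v) ^ n) * w⁻¹⁻¹) • p,
            ⟨_, Subgroup.Normal.conj_mem inferInstance _ (hvn n) _, rfl⟩, ?_⟩
          simp only [smul_smul]
          congr 1
          group)
      rwa [Set.ncard_image_of_injective _ (MulAction.injective w)] at this
    have hMq : z ^ M • w • p = w • p := by
      obtain ⟨e, he⟩ := Nat.dvd_factorial hd0 hd
      rw [hM, he, pow_mul]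
      exact MulAction.mem_stabilizer_iff.1 (pow_mem (MulAction.mem_stabilizer_iff.2 hdq) e)
    have hvM : ((z ^ M)⁻¹ * (z * v) ^ M) • w • p = w • p := by
      rw [hvq, inv_smul_eq_iff, hMq]
    refine ⟨hMq, ?_⟩
    -- Multipliers at fixed points are invariant under conjugation.
    have h1 : D (z * v) (w • p) = D z p := by
      have h2 : D (z * v * w) p = D (w * z) p := by rw [hzv, inv_mul_cancel_right]
      rw [hD, hD w z, hzp, mul_comm] at h2
      exact mul_left_cancel₀ (hpos w p).ne' h2
    have h2 : D ((z * v) ^ M) (w • p) = D z p ^ M := by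
      rw [hDpow _ _ (by simpa using hfix 1), h1]
    have h3 : (z * v) ^ M = z ^ M * ((z ^ M)⁻¹ * (z * v) ^ M) := by group
    rw [h3, hD, hvM, hmin k hki _ (hvn M) _ hvM, mul_one] at h2
    exact h2
  have h1 : D z p ^ M = 1 := hacc (z ^ M) _ (hjinf.mono (by
    rintro _ ⟨w, hw, rfl⟩
    exact key w hw))
  exact hne ((pow_eq_one_iff_of_nonneg (hpos z p).le hM0).1 h1)

theorem circleDeriv_eq_one_of_isNilpotent {N : Type*} [Group N] [Group.IsNilpotent N]
    (a : N →* circleDiff)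
    (horb : ∀ x, (Set.range fun n => (a n : UnitAddCircle ≃ₜ UnitAddCircle) x).Infinite)
    (z : N) (p : UnitAddCircle) (hz : (a z : UnitAddCircle ≃ₜ UnitAddCircle) p = p) :
    circleDeriv (a z : UnitAddCircle ≃ₜ UnitAddCircle) p = 1 := by
  let _ : MulAction N UnitAddCircle :=
    { smul := fun n x => (a n : UnitAddCircle ≃ₜ UnitAddCircle) x
      one_smul := fun x => by
        change (a 1 : UnitAddCircle ≃ₜ UnitAddCircle) x = x
        rw [map_one]
        rfl
      mul_smul := fun m n x => by
        change (a (m * n) : UnitAddCircle ≃ₜ UnitAddCircle) x = _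
        rw [map_mul]
        rfl }
  refine multiplier_eq_one_of_isNilpotent
    (fun n x => circleDeriv (a n : UnitAddCircle ≃ₜ UnitAddCircle) x) (fun g h x => ?_)
    (fun g x => circleDeriv_pos (a g).2 x)
    (fun g lam h => eq_one_of_infinite_fixedPoints (a g).2 h) horb z p hz
  rw [map_mul]
  exact circleDeriv_mul (a g).2 (a h).2 x

/-! ## Birkhoff sums over circle homeomorphisms with irrational translation number -/

theorem Irrational.exists_forall_lt_abs_mul_sub {τ : ℝ} (hτ : Irrational τ) (m : ℕ) :
    ∃ l : ℝ, 0 < l ∧ ∀ d : ℕ, 0 < d → d < m → ∀ n : ℤ, l < |d * τ - n| := by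
  induction m with
  | zero => exact ⟨1, one_pos, fun d _ h => absurd h (Nat.not_lt_zero d)⟩
  | succ m ih =>
    obtain ⟨l, hl, h⟩ := ih
    rcases Nat.eq_zero_or_pos m with rfl | hm
    · exact ⟨1, one_pos, fun d h0 h1 => by omega⟩
    have hpos : 0 < |m * τ - round (m * τ)| :=
      abs_pos.2 (sub_ne_zero.2 ((hτ.natCast_mul hm.ne').ne_int _))
    refine ⟨min l (|m * τ - round (m * τ)| / 2), by positivity, fun d h0 h1 n => ?_⟩
    rcases Nat.lt_succ_iff_lt_or_eq.1 h1 with hd | rfl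
    · exact (min_le_left _ _).trans_lt (h d h0 hd n)
    · exact (min_le_right _ _).trans_lt ((half_lt_self hpos).trans_le (round_le _ n))

/-- Density of an irrational rotation, with a number of steps independent of the target: Dirichlet
approximation gives a multiple of `τ` at nonzero distance `|θ| ≤ l` from an integer, and at most `1
/ |θ|` steps of length `|θ|` go around the circle. -/
theorem Irrational.exists_forall_exists_abs_mul_sub_le {τ : ℝ} (hτ : Irrational τ) {l : ℝ}
    (hl : 0 < l) : ∃ K : ℕ, ∀ a : ℝ, ∃ k ≤ K, ∃ n : ℤ, |k * τ - n - a| ≤ l := by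
  obtain ⟨N, hN⟩ := exists_nat_gt (1 / l)
  have hN0 : 0 < N := by
    have : (0 : ℝ) < N := (one_div_pos.2 hl).trans hN
    exact_mod_cast this
  obtain ⟨k, hk0, -, hk⟩ := Real.exists_nat_abs_mul_sub_round_le τ hN0
  set θ : ℝ := k * τ - round (k * τ) with hθ
  have hθ0 : θ ≠ 0 := sub_ne_zero.2 ((hτ.natCast_mul hk0.ne').ne_int _)
  have hθl : |θ| ≤ l := by
    refine hk.trans ?_
    rw [one_div_le (by positivity) hl]
    linarith
  refine ⟨⌊1 / |θ|⌋₊ * k, fun a => ?_⟩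
  -- Rounding `a` in the direction given by the sign of `θ` makes `a - n` a nonnegative multiple of
  -- `θ`, of modulus at most one.
  obtain ⟨n, hn0, hn1⟩ : ∃ n : ℤ, 0 ≤ (a - n) / θ ∧ (a - n) / θ ≤ 1 / |θ| := by
    rcases lt_or_gt_of_ne hθ0 with h | h
    · refine ⟨⌈a⌉, div_nonneg_of_nonpos (sub_nonpos.2 (Int.le_ceil a)) h.le, ?_⟩
      rw [abs_of_neg h, ← neg_div_neg_eq]
      have := Int.ceil_lt_add_one a
      exact div_le_div_of_nonneg_right (by linarith) (by linarith)
    · refine ⟨⌊a⌋, div_nonneg (sub_nonneg.2 (Int.floor_le a)) h.le, ?_⟩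
      rw [abs_of_pos h]
      have := Int.lt_floor_add_one a
      exact div_le_div_of_nonneg_right (by linarith) h.le
  refine ⟨⌊(a - n) / θ⌋₊ * k, Nat.mul_le_mul_right _ (Nat.floor_mono hn1),
    ⌊(a - n) / θ⌋₊ * round (k * τ) - n, ?_⟩
  have e : ((⌊(a - n) / θ⌋₊ * k : ℕ) : ℝ) * τ - ((⌊(a - n) / θ⌋₊ * round (k * τ) - n : ℤ) : ℝ) - a =
      θ * (⌊(a - n) / θ⌋₊ - (a - n) / θ) := by
    rw [mul_sub, mul_div_cancel₀ _ hθ0]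
    push_cast
    rw [hθ]
    ring
  rw [e, abs_mul]
  refine (mul_le_of_le_one_right (abs_nonneg _) ?_).trans hθl
  rw [abs_sub_comm, abs_of_nonneg (sub_nonneg.2 (Nat.floor_le hn0))]
  linarith [Nat.lt_floor_add_one ((a - n) / θ)]

/-- A real interval of length at least `δ > 1 / K` contains a point of `ℤ / K`. -/
theorem exists_int_div_between {a b δ : ℝ} {K : ℕ} (hδ : 0 < δ) (hK : 1 / δ < K)
    (h : δ ≤ |a - b|) : ∃ k : ℤ, min a b ≤ k / K ∧ k / K ≤ max a b := by
  have hK0 : (0 : ℝ) < K := (one_div_pos.2 hδ).trans hK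
  refine ⟨⌈min a b * K⌉, (le_div_iff₀ hK0).2 (Int.le_ceil _), (div_le_iff₀ hK0).2 ?_⟩
  have h1 := Int.ceil_lt_add_one (min a b * K)
  have h2 : max a b - min a b = |a - b| := max_sub_min_eq_abs' a b
  have h3 : 1 ≤ δ * K := by
    rw [div_lt_iff₀ hδ] at hK
    linarith
  have h4 : max a b = min a b + |a - b| := by linarith
  rw [h4]
  nlinarith

/-! ### Comparison of Birkhoff sums through a semiconjugacy to an irrational translation. -/

section Irrational

open CircleDeg1Lift

variable {f F : CircleDeg1Lift} {τ : ℝ}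

theorem semiconj_iterate (hF : ∀ t, F (f t) = F t + τ) (i : ℕ) (t : ℝ) :
    F (f^[i] t) = F t + i * τ := by
  induction i with
  | zero => simp
  | succ i ih =>
    rw [Function.iterate_succ_apply', hF, ih]
    push_cast
    ring

/-- If `f` is semiconjugate to an irrational translation, then the distance between two points that
are identified up to a small error is large for a bounded number of iterates only. -/
theorem card_le_of_le_abs_iterate_sub (hF : ∀ t, F (f t) = F t + τ) (hτ : Irrational τ) {δ : ℝ}
    (hδ : 0 < δ) {K : ℕ} (hK : 1 / δ < K) (m : ℕ) :
    ∃ l : ℝ, 0 < l ∧ ∀ s t, |F s - F t| ≤ l →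
      ((Finset.range m).filter fun i => δ ≤ |f^[i] s - f^[i] t|).card ≤ K := by
  classical
  have hK0 : (0 : ℝ) < K := (one_div_pos.2 hδ).trans hK
  have hK0' : (K : ℤ) ≠ 0 := by
    have : 0 < K := by exact_mod_cast hK0
    omega
  obtain ⟨l, hl, hlm⟩ := hτ.exists_forall_lt_abs_mul_sub m
  refine ⟨l / 2, half_pos hl, fun s t hst => ?_⟩
  have hex : ∀ i, ∃ k : ℤ, δ ≤ |f^[i] s - f^[i] t| →
      min (f^[i] s) (f^[i] t) ≤ k / K ∧ k / K ≤ max (f^[i] s) (f^[i] t) := fun i => by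
    by_cases h : δ ≤ |f^[i] s - f^[i] t|
    · obtain ⟨k, hk⟩ := exists_int_div_between hδ hK h
      exact ⟨k, fun _ => hk⟩
    · exact ⟨0, fun h' => absurd h' h⟩
  choose k hk using hex
  -- A grid point between the two iterates has its `F`-value trapped near `F s + i * τ`. If two such
  -- times gave grid points congruent modulo integers, then `(j - i) * τ` would be too close to an
  -- integer; so distinct times use distinct residues modulo `K`.
  have hFk : ∀ i, δ ≤ |f^[i] s - f^[i] t| → |F (k i / K) - (F s + i * τ)| ≤ l / 2 := by
    intro i hi
    obtain ⟨h1, h2⟩ := hk i hi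
    have h1' := F.monotone h1
    have h2' := F.monotone h2
    rw [F.monotone.map_min, semiconj_iterate hF, semiconj_iterate hF] at h1'
    rw [F.monotone.map_max, semiconj_iterate hF, semiconj_iterate hF] at h2'
    rw [abs_le] at hst ⊢
    rcases min_le_iff.1 h1' with h | h <;> rcases le_max_iff.1 h2' with h' | h' <;>
      constructor <;> linarith
  have hinj : ∀ i j, i < j → j < m → δ ≤ |f^[i] s - f^[i] t| → δ ≤ |f^[j] s - f^[j] t| →
      k i % K ≠ k j % K := by
    intro i j hij hj hi' hj' he
    obtain ⟨n, hn⟩ := Int.ModEq.dvd he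
    have h1 : (k j / K : ℝ) = k i / K + n := by
      rw [div_eq_iff hK0.ne', add_mul, div_mul_cancel₀ _ hK0.ne']
      have : k j = k i + n * K := by linarith
      exact_mod_cast this
    have h2 := hFk i hi'
    have h3 := hFk j hj'
    rw [h1, CircleDeg1Lift.map_add_int] at h3
    have h4 := hlm (j - i) (by omega) (by omega) n
    rw [Nat.cast_sub hij.le] at h4
    rw [abs_le] at h2 h3
    refine h4.not_ge (abs_le.2 ⟨?_, ?_⟩) <;> nlinarith
  have := Finset.card_le_card_of_injOn (s := (Finset.range m).filter fun i =>
    δ ≤ |f^[i] s - f^[i] t|) (t := (Finset.range K).image fun n : ℕ => (n : ℤ))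
    (fun i => k i % K) (fun i _ => ?_) (fun i hi j hj he => ?_)
  · exact this.trans (Finset.card_image_le.trans (Finset.card_range K).le)
  · simp only [Finset.coe_image, Set.mem_image, Finset.mem_coe, Finset.mem_range]
    refine ⟨(k i % K).toNat, ?_, Int.toNat_of_nonneg (Int.emod_nonneg _ hK0')⟩
    have := Int.emod_lt_of_pos (k i) (b := K) (by omega)
    omega
  · simp only [Finset.coe_filter, Finset.mem_range, Set.mem_ofPred_eq] at hi hj
    rcases lt_trichotomy i j with h | h | h
    · exact absurd he (hinj i j h hj.1 hi.2 hj.2)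
    · exact h
    · exact absurd he.symm (hinj j i h hi.1 hj.2 hi.2)

theorem UnitAddCircle.dist_coe_le (s t : ℝ) : dist (s : UnitAddCircle) t ≤ |s - t| := by
  rw [dist_eq_norm, ← AddCircle.coe_sub, ← Real.norm_eq_abs]
  exact QuotientAddGroup.norm_mk_le_norm

/-- Times at which the orbits are `δ`-close contribute at most `ε / 2` each, by uniform continuity.
The others number at most `K`, independently of `m`, so their total `2 * ‖v‖ * K` is at most `ε * m
/ 2` for the chosen `m`. -/
theorem abs_birkhoffSum_sub_le_of_close (hF : ∀ t, F (f t) = F t + τ) (hτ : Irrational τ)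
    (v : C(UnitAddCircle, ℝ)) {ε : ℝ} (hε : 0 < ε) :
    ∃ m : ℕ, 0 < m ∧ ∃ l : ℝ, 0 < l ∧ ∀ s t, |F s - F t| ≤ l →
      |birkhoffSum f (fun r => v r) m s - birkhoffSum f (fun r => v r) m t| ≤ ε * m := by
  obtain ⟨δ, hδ, hv⟩ := Metric.uniformContinuous_iff.1
    (CompactSpace.uniformContinuous_of_continuous v.continuous) (ε / 2) (half_pos hε)
  obtain ⟨K, hK⟩ := exists_nat_gt (1 / δ)
  obtain ⟨m, hm⟩ := exists_nat_gt (4 * ‖v‖ * K / ε)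
  have hm0 : (0 : ℝ) < m := lt_of_le_of_lt (by positivity) hm
  obtain ⟨l, hl, h⟩ := card_le_of_le_abs_iterate_sub hF hτ hδ hK m
  refine ⟨m, by exact_mod_cast hm0, l, hl, fun s t hst => ?_⟩
  have hterm : ∀ i, |v (f^[i] s : ℝ) - v (f^[i] t : ℝ)| ≤
      ε / 2 + if δ ≤ |f^[i] s - f^[i] t| then 2 * ‖v‖ else 0 := by
    intro i
    split_ifs with hi
    · have h1 := v.norm_coe_le_norm (f^[i] s : ℝ)
      have h2 := v.norm_coe_le_norm (f^[i] t : ℝ)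
      have h3 := norm_sub_le (v (f^[i] s : ℝ)) (v (f^[i] t : ℝ))
      rw [Real.norm_eq_abs (_ - _)] at h3
      linarith
    · rw [add_zero, ← Real.dist_eq]
      exact (hv ((UnitAddCircle.dist_coe_le _ _).trans_lt (not_le.1 hi))).le
  rw [birkhoffSum, birkhoffSum, ← Finset.sum_sub_distrib]
  refine (Finset.abs_sum_le_sum_abs _ _).trans ((Finset.sum_le_sum fun i _ => hterm i).trans ?_)
  rw [Finset.sum_add_distrib, Finset.sum_const, Finset.card_range, ← Finset.sum_filter,
    Finset.sum_const, nsmul_eq_mul, nsmul_eq_mul]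
  have h1 : ((((Finset.range m).filter fun i => δ ≤ |f^[i] s - f^[i] t|).card : ℕ) : ℝ) ≤ K := by
    exact_mod_cast h s t hst
  have h2 : 4 * ‖v‖ * K < m * ε := (div_lt_iff₀ hε).1 hm
  have h3 := mul_le_mul_of_nonneg_right h1 (show 0 ≤ 2 * ‖v‖ by positivity)
  linarith

/-- The sum splits into `L` blocks of length `m`, and each block starts at a pair still related by
`P`. For `P` expressing closeness of `F`-values, invariance holds because translations are
isometries. -/
theorem abs_birkhoffSum_mul_sub_le {α : Type*} {g : α → α} {φ : α → ℝ} {P : α → α → Prop}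
    (hP : ∀ x y, P x y → P (g x) (g y)) {m : ℕ} {B : ℝ}
    (h : ∀ x y, P x y → |birkhoffSum g φ m x - birkhoffSum g φ m y| ≤ B) (L : ℕ) {x y : α}
    (hxy : P x y) : |birkhoffSum g φ (m * L) x - birkhoffSum g φ (m * L) y| ≤ B * L := by
  have hPi : ∀ n, P (g^[n] x) (g^[n] y) := fun n => by
    induction n with
    | zero => exact hxy
    | succ n ih => rw [Function.iterate_succ_apply', Function.iterate_succ_apply']; exact hP _ _ ih
  induction L with
  | zero => simp
  | succ L ih =>
    rw [Nat.mul_succ, birkhoffSum_add, birkhoffSum_add, add_sub_add_comm]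
    refine (abs_add_le _ _).trans ((add_le_add ih (h _ _ (hPi _))).trans_eq ?_)
    push_cast
    ring

/-- Shifting the starting point by one step exchanges one term at each end. -/
theorem abs_birkhoffSum_iterate_sub_le {α : Type*} {g : α → α} {φ : α → ℝ} {M : ℝ}
    (hM : ∀ x, |φ x| ≤ M) (n k : ℕ) (x : α) :
    |birkhoffSum g φ n (g^[k] x) - birkhoffSum g φ n x| ≤ 2 * M * k := by
  induction k with
  | zero => simp
  | succ k ih =>
    have h1 := birkhoffSum_apply_sub_birkhoffSum g φ n (g^[k] x)
    have h2 := abs_le.1 (hM (g^[n] (g^[k] x)))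
    have h3 := abs_le.1 (hM (g^[k] x))
    rw [abs_le] at ih ⊢
    rw [Function.iterate_succ_apply']
    push_cast
    constructor <;> linarith

theorem birkhoffSum_add_int (f : CircleDeg1Lift) (φ : UnitAddCircle → ℝ) (m : ℕ) (t : ℝ) (n : ℤ) :
    birkhoffSum f (fun r : ℝ => φ r) m (t + n) = birkhoffSum f (fun r : ℝ => φ r) m t := by
  refine Finset.sum_congr rfl fun i _ => ?_
  rw [← CircleDeg1Lift.coe_pow, CircleDeg1Lift.map_add_int]
  exact congrArg φ (UnitAddCircle.coe_eq_coe_iff.2 ⟨n, rfl⟩)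

/-- Birkhoff averages of a continuous function over a circle homeomorphism with irrational
translation number become uniformly close to constants. -/
theorem exists_abs_birkhoffSum_sub_le (u : CircleDeg1Liftˣ)
    (hτ : Irrational (translationNumber u)) (v : C(UnitAddCircle, ℝ)) {ε : ℝ} (hε : 0 < ε) :
    ∃ n : ℕ, 0 < n ∧ ∀ s t, |birkhoffSum u (fun r : ℝ => v r) n s -
      birkhoffSum u (fun r : ℝ => v r) n t| ≤ ε * n := by
  obtain ⟨F, hF'⟩ := units_semiconj_of_translationNumber_eq (f₁ := u)
    (f₂ := translate (Multiplicative.ofAdd (translationNumber u)))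
    (translationNumber_translate _).symm
  have hF : ∀ t, F ((u : CircleDeg1Lift) t) = F t + translationNumber u := fun t => by
    have := hF' t
    rwa [translate_apply, add_comm] at this
  obtain ⟨m, hm, l, hl, h⟩ := abs_birkhoffSum_sub_le_of_close hF hτ v (half_pos hε)
  obtain ⟨K, hK⟩ := hτ.exists_forall_exists_abs_mul_sub_le hl
  obtain ⟨L, hL⟩ := exists_nat_gt (4 * ‖v‖ * K / ε)
  have hL0 : (0 : ℝ) < L := lt_of_le_of_lt (by positivity) hL
  have hm1 : (1 : ℝ) ≤ m := by exact_mod_cast hm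
  refine ⟨m * L, Nat.mul_pos hm (by exact_mod_cast hL0), fun s t => ?_⟩
  -- At most `K` iterations bring `s` close to an integer translate of `t` as seen by `F`. This
  -- costs `2 * ‖v‖ * K`, which the choice of `L` absorbs.
  obtain ⟨k, hk, n, hkn⟩ := hK (F t - F s)
  have h1 := abs_birkhoffSum_iterate_sub_le (g := (u : CircleDeg1Lift))
    (φ := fun r : ℝ => v r) (fun r => v.norm_coe_le_norm (r : UnitAddCircle)) (m * L) k s
  have h2 := abs_birkhoffSum_mul_sub_le (g := (u : CircleDeg1Lift)) (φ := fun r : ℝ => v r)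
    (P := fun s t => |F s - F t| ≤ l) (fun x y hxy => by rwa [hF, hF, add_sub_add_right_eq_sub])
    h L (x := (u : CircleDeg1Lift)^[k] s) (y := t + n) (by
      rw [semiconj_iterate hF, CircleDeg1Lift.map_add_int]
      convert hkn using 2
      ring)
  rw [birkhoffSum_add_int] at h2
  have hk' : (k : ℝ) ≤ K := by exact_mod_cast hk
  have h3 : 2 * ‖v‖ * k ≤ 2 * ‖v‖ * K := mul_le_mul_of_nonneg_left hk' (by positivity)
  have h4 : 4 * ‖v‖ * K < L * ε := (div_lt_iff₀ hε).1 hL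
  have h5 : L * ε ≤ ε * (m * L) := by nlinarith [mul_pos hL0 hε]
  rw [abs_le] at h1 h2 ⊢
  push_cast
  constructor <;> linarith

end Irrational

/-! ## Birkhoff sums over lifts with a fixed point -/

/-- If a degree one lift `f` has a fixed point and a continuous function `v` vanishes at all
fixed points of `f`, then the Birkhoff averages of `v` become uniformly small. -/
theorem exists_abs_birkhoffSum_le_of_fixedPoint (f : CircleDeg1Lift) (hf : Continuous f) {t₀ : ℝ}
    (ht₀ : f t₀ = t₀) (v : C(UnitAddCircle, ℝ)) (hv : ∀ t : ℝ, f t = t → v t = 0) {ε : ℝ}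
    (hε : 0 < ε) :
    ∃ n : ℕ, 0 < n ∧ ∀ t, |birkhoffSum f (fun r : ℝ => v r) n t| ≤ ε * n := by
  -- The set where `|v| ≥ ε / 2` within a period is compact and free of fixed points, so the
  -- displacement is bounded below on it.
  obtain ⟨C, hC0, hC⟩ : ∃ C : ℝ, 0 ≤ C ∧ ∀ t : ℝ, |v t| ≤ ε / 2 + C * |f t - t| := by
    obtain ⟨δ, hδ, hδ'⟩ : ∃ δ : ℝ, 0 < δ ∧
        ∀ t ∈ Set.Icc (0 : ℝ) 1, ε / 2 ≤ |v t| → δ ≤ |f t - t| := by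
      set Q : Set ℝ := {t | t ∈ Set.Icc (0 : ℝ) 1 ∧ ε / 2 ≤ |v t|} with hQ
      have hQc : IsCompact Q := isCompact_Icc.inter_right (isClosed_le continuous_const
        (v.continuous.comp (AddCircle.continuous_mk' _)).abs)
      rcases Q.eq_empty_or_nonempty with h | h
      · refine ⟨1, one_pos, fun t ht hvt => ?_⟩
        have : t ∈ Q := ⟨ht, hvt⟩
        simp [h] at this
      · obtain ⟨r, hr, hmin⟩ := hQc.exists_isMinOn h (f := fun t => |f t - t|)
          (hf.sub continuous_id).abs.continuousOn
        refine ⟨|f r - r|, abs_pos.2 (sub_ne_zero.2 fun he => ?_), fun t ht hvt => hmin ⟨ht, hvt⟩⟩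
        have := hr.2
        rw [hv r he, abs_zero] at this
        linarith
    refine ⟨‖v‖ / δ, by positivity, fun t => ?_⟩
    have hper : ((Int.fract t : ℝ) : UnitAddCircle) = t := AddCircle.coe_fract t
    rw [← hper, ← f.map_fract_sub_fract_eq]
    rcases le_total (ε / 2) |v (Int.fract t : ℝ)| with h | h
    · have h1 := hδ' _ ⟨Int.fract_nonneg t, (Int.fract_lt_one t).le⟩ h
      have h2 : |v (Int.fract t : ℝ)| ≤ ‖v‖ := v.norm_coe_le_norm _
      have h3 : ‖v‖ ≤ ‖v‖ / δ * |f (Int.fract t) - Int.fract t| := by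
        rw [div_mul_eq_mul_div, le_div_iff₀ hδ]
        exact mul_le_mul_of_nonneg_left h1 (norm_nonneg _)
      linarith
    · exact h.trans (le_add_of_nonneg_right (by positivity))
  -- Orbits stay between two consecutive integer translates of `t₀`.
  have hdisp : ∀ n t, |f^[n] t - t| ≤ 1 := by
    intro n t
    have hfix : ∀ k : ℤ, f^[n] (t₀ + k) = t₀ + k := fun k => by
      rw [← CircleDeg1Lift.coe_pow, CircleDeg1Lift.map_add_int, CircleDeg1Lift.coe_pow,
        Function.iterate_fixed ht₀]
    have h1 := f.monotone.iterate n
      (show t₀ + (⌊t - t₀⌋ : ℤ) ≤ t by linarith [Int.floor_le (t - t₀)])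
    have h2 := f.monotone.iterate n
      (show t ≤ t₀ + ((⌊t - t₀⌋ + 1 : ℤ) : ℝ) by
        push_cast
        linarith [Int.lt_floor_add_one (t - t₀)])
    rw [hfix] at h1 h2
    push_cast at h2
    rw [abs_le]
    constructor <;> linarith [Int.floor_le (t - t₀), Int.lt_floor_add_one (t - t₀)]
  -- An orbit of a monotone map is monotone, so the displacements all have the same sign and
  -- telescope.
  have hsum : ∀ n t, ∑ i ∈ Finset.range n, |f (f^[i] t) - f^[i] t| = |f^[n] t - t| := by
    intro n t
    rcases le_total t (f t) with h | h
    · have hm := f.monotone.monotone_iterate_of_le_map h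
      have hn : t ≤ f^[n] t := hm (Nat.zero_le n)
      rw [abs_of_nonneg (sub_nonneg.2 hn)]
      refine (Finset.sum_congr rfl fun i _ => ?_).trans
        (Finset.sum_range_sub (fun i => f^[i] t) n)
      have hi : f^[i] t ≤ f^[i + 1] t := hm (Nat.le_succ i)
      rw [← Function.iterate_succ_apply' f, abs_of_nonneg (sub_nonneg.2 hi)]
    · have hm := f.monotone.antitone_iterate_of_map_le h
      have hn : f^[n] t ≤ t := hm (Nat.zero_le n)
      rw [abs_of_nonpos (sub_nonpos.2 hn), neg_sub]
      refine (Finset.sum_congr rfl fun i _ => ?_).trans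
        (Finset.sum_range_sub' (fun i => f^[i] t) n)
      have hi : f^[i + 1] t ≤ f^[i] t := hm (Nat.le_succ i)
      rw [← Function.iterate_succ_apply' f, abs_of_nonpos (sub_nonpos.2 hi), neg_sub]
  obtain ⟨n, hn⟩ := exists_nat_gt (2 * C / ε)
  have hn0 : (0 : ℝ) < n := lt_of_le_of_lt (by positivity) hn
  refine ⟨n, by exact_mod_cast hn0, fun t => ?_⟩
  refine (Finset.abs_sum_le_sum_abs _ _).trans ((Finset.sum_le_sum fun i _ => hC _).trans ?_)
  rw [Finset.sum_add_distrib, ← Finset.mul_sum, hsum, Finset.sum_const, Finset.card_range,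
    nsmul_eq_mul]
  have h1 := mul_le_mul_of_nonneg_left (hdisp n t) hC0
  have h2 : 2 * C < n * ε := (div_lt_iff₀ hε).1 hn
  linarith

/-! ## Sublinear growth of the logarithmic derivative -/

theorem circleLogDeriv_pow (g : circleDiff) (n : ℕ) (x : UnitAddCircle) :
    circleLogDeriv (g ^ n) x =
      birkhoffSum (g : UnitAddCircle ≃ₜ UnitAddCircle) (circleLogDeriv g) n x := by
  induction n generalizing x with
  | zero =>
    change Real.log (circleDeriv (1 : UnitAddCircle ≃ₜ UnitAddCircle) x) = 0
    rw [circleDeriv_one, Real.log_one]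
  | succ n ih =>
    have h : circleLogDeriv (g ^ n * g) x = circleLogDeriv (g ^ n) (g.1 x) + circleLogDeriv g x :=
      DFunLike.congr_fun (logDerivCocycle.c_mul (g ^ n) g) x
    rw [pow_succ, h, ih, birkhoffSum_succ', add_comm]

theorem IsLift.birkhoffSum_eq {F : ℝ → ℝ} {g : UnitAddCircle → UnitAddCircle} (h : IsLift F g)
    (φ : UnitAddCircle → ℝ) (n : ℕ) (t : ℝ) :
    birkhoffSum F (fun r : ℝ => φ r) n t = birkhoffSum g φ n t := by
  have hi : ∀ i, ((F^[i] t : ℝ) : UnitAddCircle) = g^[i] t := fun i => by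
    induction i with
    | zero => rfl
    | succ i ih => rw [Function.iterate_succ_apply', Function.iterate_succ_apply', h.2, ih]
  exact Finset.sum_congr rfl fun i _ => congrArg φ (hi i)

theorem IsLift.pow {u : CircleDeg1Lift} {g : UnitAddCircle ≃ₜ UnitAddCircle} (h : IsLift u g)
    (n : ℕ) : IsLift (u ^ n : CircleDeg1Lift) (g ^ n : UnitAddCircle ≃ₜ UnitAddCircle) := by
  induction n with
  | zero => exact ⟨continuous_id, fun _ => rfl⟩
  | succ n ih => rw [pow_succ, pow_succ]; exact ih.comp h

/-- A lift grows by exactly `1` over a period, so its derivative equals `1` somewhere by the mean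
value theorem. -/
theorem exists_circleLogDeriv_eq_zero {g : circleDiff} : ∃ x, circleLogDeriv g x = 0 := by
  obtain ⟨u, hu, hus⟩ := exists_units_isLift g.2
  obtain ⟨t, -, ht⟩ := exists_deriv_eq_slope (u : CircleDeg1Lift) (zero_lt_one (α := ℝ))
    hus.continuous.continuousOn (hus.differentiable one_ne_zero).differentiableOn
  refine ⟨t, ?_⟩
  change Real.log (circleDeriv g.1 (t : UnitAddCircle)) = 0
  rw [circleDeriv_coe hu, ht]
  have h1 := (u : CircleDeg1Lift).map_add_one 0
  rw [zero_add] at h1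
  rw [h1]
  simp

theorem hasSublinearPowers_logDerivCocycle {N : Type*} [Group N] [Group.IsNilpotent N]
    (a : N →* circleDiff)
    (horb : ∀ x, (Set.range fun n => (a n : UnitAddCircle ≃ₜ UnitAddCircle) x).Infinite) :
    (logDerivCocycle.comap a).HasSublinearPowers := by
  intro z ε hε
  change ∃ n : ℕ, 0 < n ∧ ‖circleLogDeriv (a (z ^ n))‖ ≤ ε * n
  obtain ⟨u, hu, -⟩ := exists_units_isLift (a z).2
  by_cases hτ : Irrational (CircleDeg1Lift.translationNumber u)
  · obtain ⟨n, hn, h⟩ := exists_abs_birkhoffSum_sub_le u hτ (circleLogDeriv (a z)) hε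
    refine ⟨n, hn, (ContinuousMap.norm_le _ (by positivity)).2 fun x => ?_⟩
    -- The zero of `log D(z ^ n)` turns closeness to a constant into smallness.
    obtain ⟨y, hy⟩ := exists_circleLogDeriv_eq_zero (g := a (z ^ n))
    obtain ⟨t, rfl⟩ := QuotientAddGroup.mk_surjective x
    obtain ⟨s, rfl⟩ := QuotientAddGroup.mk_surjective y
    have h1 := h t s
    rw [hu.birkhoffSum_eq, hu.birkhoffSum_eq] at h1
    rw [map_pow, circleLogDeriv_pow] at hy ⊢
    have hy' : birkhoffSum (a z).1 (circleLogDeriv (a z)) n (s : UnitAddCircle) = 0 := hy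
    rw [hy', sub_zero] at h1
    exact h1
  · obtain ⟨r, hr⟩ : ∃ r : ℚ, (r : ℝ) = CircleDeg1Lift.translationNumber u := by
      simpa [Irrational] using hτ
    have hu' := hu.pow r.den
    obtain ⟨t₀, ht₀⟩ : ∃ t₀, ((u : CircleDeg1Lift) ^ r.den) t₀ = t₀ + r.num := by
      rw [← CircleDeg1Lift.translationNumber_eq_int_iff _ hu'.1,
        CircleDeg1Lift.translationNumber_pow, ← hr]
      exact_mod_cast Rat.den_mul_eq_num r
    -- The lift of `z ^ r.den` corrected by an integer so that `t₀` is a genuine fixed point.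
    set f : CircleDeg1Lift :=
      CircleDeg1Lift.translate (Multiplicative.ofAdd (-r.num : ℝ)) * (u : CircleDeg1Lift) ^ r.den
    have hf : ∀ t, f t = ((u : CircleDeg1Lift) ^ r.den) t + ((-r.num : ℤ) : ℝ) := fun t => by
      rw [CircleDeg1Lift.mul_apply, CircleDeg1Lift.translate_apply, add_comm, Int.cast_neg]
    have hfl : IsLift f (a (z ^ r.den) : UnitAddCircle ≃ₜ UnitAddCircle) := by
      rw [map_pow, show ⇑f = fun t => _ from funext hf]
      exact hu'.add_intCast _
    obtain ⟨n, hn, h⟩ := exists_abs_birkhoffSum_le_of_fixedPoint f hfl.1 (t₀ := t₀)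
      (by rw [hf, ht₀]; simp) (circleLogDeriv (a (z ^ r.den)))
      (fun t ht => by
        change Real.log (circleDeriv _ _) = 0
        rw [circleDeriv_eq_one_of_isNilpotent a horb, Real.log_one]
        rw [← hfl.2, ht]) hε
    refine ⟨r.den * n, Nat.mul_pos r.den_pos hn,
      (ContinuousMap.norm_le _ (by positivity)).2 fun x => ?_⟩
    obtain ⟨t, rfl⟩ := QuotientAddGroup.mk_surjective x
    have h1 := h t
    rw [hfl.birkhoffSum_eq, ← circleLogDeriv_pow, ← map_pow, ← pow_mul] at h1
    refine h1.trans ?_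
    have hden : (1 : ℝ) ≤ r.den := by exact_mod_cast r.den_pos
    have hn' : (0 : ℝ) ≤ ε * n := by positivity
    push_cast
    nlinarith

/-! ## Additivity of the translation number -/

open CircleDeg1Lift in
/-- A map whose displacement is cohomologous to a function close to a constant has translation
number close to this constant. -/
theorem abs_sub_translationNumber_le (f : CircleDeg1Lift) (v : C(UnitAddCircle, ℝ)) {κ ε : ℝ}
    (h : ∀ t : ℝ, |(f t - t + v (f t : ℝ) - v (t : ℝ)) - κ| ≤ ε) :
    |κ - translationNumber f| ≤ ε := by
  have hn : ∀ n : ℕ, |(f^[n] 0 + v (f^[n] 0 : ℝ)) - v (0 : ℝ) - n * κ| ≤ n * ε := fun n => by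
    induction n with
    | zero => simp
    | succ n ih =>
      have h1 := h (f^[n] 0)
      rw [Function.iterate_succ_apply']
      rw [abs_le] at ih h1 ⊢
      rw [Nat.cast_succ]
      constructor <;> linarith
  by_contra hlt
  obtain ⟨n, hn'⟩ := exists_nat_gt ((2 * ‖v‖ + 1) / (|κ - translationNumber f| - ε))
  rw [div_lt_iff₀ (by linarith)] at hn'
  have h1 := hn n
  have h2 := f.dist_pow_map_zero_mul_translationNumber_le n
  rw [Real.dist_eq, CircleDeg1Lift.coe_pow] at h2
  have h3 := abs_le.1 (v.norm_coe_le_norm (f^[n] 0 : ℝ))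
  have h4 := abs_le.1 (v.norm_coe_le_norm (0 : ℝ))
  rw [abs_le] at h1 h2
  have h5 : |n * (κ - translationNumber f)| ≤ n * ε + 2 * ‖v‖ + 1 := by
    rw [abs_le]
    constructor <;> linarith
  rw [abs_mul, Nat.abs_cast] at h5
  linarith

/-- The bound is the same for all lifts: the displacement cocycle is therefore bounded in the
oscillation seminorm, and its growth along powers is trivially sublinear. -/
theorem CircleDeg1Lift.abs_displacement_sub_le (f : CircleDeg1Lift) (s t : ℝ) :
    |(f s - s) - (f t - t)| ≤ 1 := by
  rw [← f.map_fract_sub_fract_eq s, ← f.map_fract_sub_fract_eq t]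
  have h1 := Int.fract_nonneg s
  have h2 := Int.fract_lt_one s
  have h3 := Int.fract_nonneg t
  have h4 := Int.fract_lt_one t
  have h5 := f.map_add_one (Int.fract s)
  have h6 := f.map_add_one (Int.fract t)
  have h7 := f.monotone (show Int.fract s ≤ Int.fract t + 1 by linarith)
  have h8 := f.monotone (show Int.fract t ≤ Int.fract s + 1 by linarith)
  rw [abs_le]
  rcases le_total (Int.fract s) (Int.fract t) with h | h <;> have h9 := f.monotone h <;>
    constructor <;> linarith

/-- The difference of the values of a function at two points. -/
def valueDifference :
    C(UnitAddCircle, ℝ) →ₗ[ℝ] C(UnitAddCircle × UnitAddCircle, ℝ) where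
  toFun v := v.comp ⟨Prod.fst, continuous_fst⟩ - v.comp ⟨Prod.snd, continuous_snd⟩
  map_add' v w := by
    ext x
    change v x.1 + w x.1 - (v x.2 + w x.2) = v x.1 - v x.2 + (w x.1 - w x.2)
    ring
  map_smul' r v := by
    ext x
    exact (mul_sub r (v x.1) (v x.2)).symm

/-- The oscillation of a continuous function on the circle, as a seminorm. -/
noncomputable def oscSeminorm : Seminorm ℝ C(UnitAddCircle, ℝ) :=
  (normSeminorm ℝ C(UnitAddCircle × UnitAddCircle, ℝ)).comp valueDifference

theorem oscSeminorm_le_iff (v : C(UnitAddCircle, ℝ)) {B : ℝ} (hB : 0 ≤ B) :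
    oscSeminorm v ≤ B ↔ ∀ x y, |v x - v y| ≤ B :=
  (ContinuousMap.norm_le (valueDifference v) hB).trans Prod.forall

/-- The group of pairs of a homeomorphism of the circle and an invertible degree one lift. -/
def circleLifts : Subgroup (CircleDeg1Liftˣ × (UnitAddCircle ≃ₜ UnitAddCircle)) where
  carrier := {w | IsLift w.1 w.2}
  mul_mem' := fun hv hw => hv.comp hw
  one_mem' := ⟨continuous_id, fun _ => rfl⟩
  inv_mem' := fun hw => hw.inv

/-- The displacement of a lift, as a function on the circle. -/
noncomputable def circleDisplacement (w : circleLifts) : C(UnitAddCircle, ℝ) where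
  toFun := Function.Periodic.lift (f := fun t : ℝ => (w.1.1 : CircleDeg1Lift) t - t) (c := 1)
    fun t => by simp only [CircleDeg1Lift.map_add_one, add_sub_add_right_eq_sub]
  continuous_toFun := UnitAddCircle.continuous_of_comp_coe (w.2.1.sub continuous_id)

theorem circleDisplacement_coe (w : circleLifts) (t : ℝ) :
    circleDisplacement w (t : UnitAddCircle) = (w.1.1 : CircleDeg1Lift) t - t := rfl

/-- The displacement as a cocycle over the group of lifts, modulo constants. -/
noncomputable def displacementCocycle : IsometricCocycle circleLifts C(UnitAddCircle, ℝ) where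
  p := oscSeminorm
  R w :=
    { toFun := fun v => v.comp ⟨w.1.2, w.1.2.continuous⟩
      map_add' := fun _ _ => rfl
      map_smul' := fun _ _ => rfl }
  R_one v := rfl
  R_mul g h v := rfl
  p_R w v := by
    change oscSeminorm (v.comp ⟨w.1.2, w.1.2.continuous⟩) = oscSeminorm v
    refine le_antisymm ?_ ?_
    · rw [oscSeminorm_le_iff _ (apply_nonneg _ _)]
      exact fun x y => (oscSeminorm_le_iff v (apply_nonneg _ _)).1 le_rfl _ _
    · rw [oscSeminorm_le_iff _ (apply_nonneg _ _)]
      intro x y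
      have h := (oscSeminorm_le_iff (v.comp ⟨w.1.2, w.1.2.continuous⟩) (apply_nonneg _ _)).1
        le_rfl (w.1.2.symm x) (w.1.2.symm y)
      simpa using h
  c := circleDisplacement
  c_mul g h := by
    ext x
    obtain ⟨t, rfl⟩ := QuotientAddGroup.mk_surjective x
    change circleDisplacement (g * h) (t : UnitAddCircle) =
      circleDisplacement g (h.1.2 (t : UnitAddCircle)) + circleDisplacement h (t : UnitAddCircle)
    rw [← h.2.2, circleDisplacement_coe, circleDisplacement_coe, circleDisplacement_coe]
    change (g.1.1 : CircleDeg1Lift) ((h.1.1 : CircleDeg1Lift) t) - t = _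
    ring

/-- The projection from lifts to circle homeomorphisms. -/
def circleLiftsProj : circleLifts →* (UnitAddCircle ≃ₜ UnitAddCircle) :=
  (MonoidHom.snd _ _).comp circleLifts.subtype

/-- Lifts of the identity are integer translations, which commute with every degree one map. -/
theorem ker_circleLiftsProj_le_center : circleLiftsProj.ker ≤ Subgroup.center circleLifts := by
  intro w hw
  have hw' : w.1.2 = 1 := hw
  have h1 : IsLift w.1.1 (1 : UnitAddCircle ≃ₜ UnitAddCircle) := hw' ▸ w.2
  obtain ⟨c, hc⟩ := h1.exists_eq_add_const (G := id) ⟨continuous_id, fun _ => rfl⟩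
  obtain ⟨n, hn⟩ := UnitAddCircle.coe_eq_coe_iff.1 (h1.2 0)
  have hcn : c = n := by
    have := hc 0
    simp only [id] at this
    linarith
  subst hcn
  rw [Subgroup.mem_center_iff]
  intro v
  refine Subtype.ext (Prod.ext (Units.ext (CircleDeg1Lift.ext fun t => ?_)) ?_)
  · change (v.1.1 : CircleDeg1Lift) ((w.1.1 : CircleDeg1Lift) t) =
      (w.1.1 : CircleDeg1Lift) ((v.1.1 : CircleDeg1Lift) t)
    rw [hc, hc, id, id, CircleDeg1Lift.map_add_int]
  · change v.1.2 * w.1.2 = w.1.2 * v.1.2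
    rw [hw', mul_one, one_mul]

open CircleDeg1Lift in
-- After adding a coboundary the displacements of `w₁`, `w₂` and `w₁ * w₂` are nearly constant,
-- hence near their translation numbers, and the cocycle identity then adds these constants up to a
-- small error.
theorem translationNumber_mul_of_isVirtuallyNilpotent
    {Γ : Subgroup (UnitAddCircle ≃ₜ UnitAddCircle)} (hΓ : Group.IsVirtuallyNilpotent Γ)
    (w₁ w₂ : Γ.comap circleLiftsProj) :
    translationNumber (w₁ * w₂).1.1.1 =
      translationNumber w₁.1.1.1 + translationNumber w₂.1.1.1 := by
  obtain ⟨N, hN, hNi⟩ := hΓ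
  set ψ := circleLiftsProj.subgroupComap Γ with hψ
  -- The lifts of elements of `N` form a central extension of a nilpotent group.
  have hnil : Group.IsNilpotent (N.comap ψ) := by
    refine Subgroup.isNilpotent_of_ker_le_center (ψ.subgroupComap N) fun w hw => ?_
    have h1 : (w : Γ.comap circleLiftsProj).1 ∈ circleLiftsProj.ker := by
      have h2 : ψ.subgroupComap N w = 1 := hw
      exact congrArg (fun n : N => ((n : Γ) : UnitAddCircle ≃ₜ UnitAddCircle)) h2
    have h2 := Subgroup.mem_center_iff.1 (ker_circleLiftsProj_le_center h1)
    exact Subgroup.mem_center_iff.2 fun v => Subtype.ext (Subtype.ext (h2 _))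
  have : (N.comap ψ).FiniteIndex :=
    ⟨by rw [Subgroup.index_comap]; exact Subgroup.FiniteIndex.index_ne_zero (H := N.subgroupOf _)⟩
  set C := displacementCocycle.comap (Γ.comap circleLiftsProj).subtype with hC
  have hsub : (C.comap (N.comap ψ).subtype).HasSublinearPowers := by
    intro w ε hε
    obtain ⟨n, hn⟩ := exists_nat_gt (1 / ε)
    have hn0 : (0 : ℝ) < n := (one_div_pos.2 hε).trans hn
    refine ⟨n, by exact_mod_cast hn0, ?_⟩
    have h1 : 1 ≤ ε * n := by
      rw [div_lt_iff₀ hε] at hn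
      linarith
    refine le_trans ?_ h1
    refine (oscSeminorm_le_iff _ zero_le_one).2 fun x y => ?_
    obtain ⟨s, rfl⟩ := QuotientAddGroup.mk_surjective x
    obtain ⟨t, rfl⟩ := QuotientAddGroup.mk_surjective y
    exact CircleDeg1Lift.abs_displacement_sub_le _ s t
  classical
  -- Four errors of size `ε`: one for each of the three translation numbers, and one for evaluating
  -- the cocycle of `w₁` at the image of `0` instead of at `0`.
  have key : ∀ ε : ℝ, 0 < ε → |translationNumber (w₁ * w₂).1.1.1 -
      (translationNumber w₁.1.1.1 + translationNumber w₂.1.1.1)| ≤ 4 * ε := by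
    intro ε hε
    obtain ⟨v, hv⟩ := C.exists_twist_le_of_finiteIndex (N.comap ψ) hsub {w₁, w₂, w₁ * w₂} hε
    have hosc : ∀ w ∈ ({w₁, w₂, w₁ * w₂} : Finset (Γ.comap circleLiftsProj)),
        (∀ x y, |(C.twist v).c w x - (C.twist v).c w y| ≤ ε) ∧
        |(C.twist v).c w (0 : ℝ) - translationNumber w.1.1.1| ≤ ε := by
      intro w hw
      have h1 := (oscSeminorm_le_iff _ hε.le).1 (hv w hw)
      refine ⟨h1, abs_sub_translationNumber_le w.1.1.1 v fun t => ?_⟩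
      have h2 := h1 (t : UnitAddCircle) (0 : ℝ)
      have e : (C.twist v).c w (t : UnitAddCircle) = (w.1.1.1 : CircleDeg1Lift) t - t +
          v (((w.1.1.1 : CircleDeg1Lift) t : ℝ) : UnitAddCircle) - v (t : UnitAddCircle) := by
        rw [w.1.2.2]
        rfl
      rwa [← e]
    obtain ⟨h1, h1'⟩ := hosc w₁ (by simp)
    obtain ⟨h2, h2'⟩ := hosc w₂ (by simp)
    obtain ⟨h3, h3'⟩ := hosc (w₁ * w₂) (by simp)
    have h4 : (C.twist v).c (w₁ * w₂) (0 : ℝ) = (C.twist v).c w₁ (w₂.1.1.2 (0 : ℝ)) +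
        (C.twist v).c w₂ (0 : ℝ) := DFunLike.congr_fun ((C.twist v).c_mul w₁ w₂) _
    have h5 := h1 (w₂.1.1.2 (0 : ℝ)) (0 : ℝ)
    rw [abs_le] at *
    constructor <;> linarith
  refine eq_of_forall_dist_le fun ε hε => ?_
  rw [Real.dist_eq]
  have := key (ε / 4) (by linarith)
  linarith

open CircleDeg1Lift in
/-- A virtually nilpotent group of circle homeomorphisms is semiconjugate, by a monotone map of
degree one that need not be continuous, to a group of rotations. -/
theorem exists_semiconj_translationNumber {Γ : Subgroup (UnitAddCircle ≃ₜ UnitAddCircle)}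
    (hΓ : Group.IsVirtuallyNilpotent Γ) :
    ∃ F : CircleDeg1Lift, ∀ (u : CircleDeg1Liftˣ) (g : UnitAddCircle ≃ₜ UnitAddCircle), g ∈ Γ →
      IsLift u g → ∀ t, F (u t) = F t + translationNumber u := by
  set T : Γ.comap circleLiftsProj →* Multiplicative ℝ :=
    MonoidHom.mk' (fun w => Multiplicative.ofAdd (translationNumber w.1.1.1))
      fun w₁ w₂ => translationNumber_mul_of_isVirtuallyNilpotent hΓ w₁ w₂
  -- Additivity makes the translations by `T` a second action of the same group with the same
  -- translation numbers; two such actions by invertible lifts are semiconjugate.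
  obtain ⟨F, hF⟩ := semiconj_of_group_action_of_forall_translationNumber_eq
    ((Units.coeHom CircleDeg1Lift).comp ((MonoidHom.fst _ _).comp
      (circleLifts.subtype.comp (Γ.comap circleLiftsProj).subtype)))
    ((Units.coeHom CircleDeg1Lift).comp (translate.comp T))
    (fun w => (translationNumber_translate _).symm)
  refine ⟨F, fun u g hg hu t => ?_⟩
  have h := hF ⟨⟨(u, g), hu⟩, hg⟩ t
  rw [add_comm]
  exact h

/-! ## Finite orbits and rotation numbers -/

open CircleDeg1Lift

theorem finite_orbit_of_finiteIndex {X : Type*} {G : Type*} [Group G] [MulAction G X]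
    (N : Subgroup G) [N.FiniteIndex] {x : X} (h : (MulAction.orbit N x).Finite) :
    (MulAction.orbit G x).Finite := by
  have : Finite (G ⧸ N) := N.finite_quotient_of_finiteIndex
  refine (Set.finite_iUnion fun q : G ⧸ N => h.image (q.out • ·)).subset ?_
  rintro _ ⟨g, rfl⟩
  refine Set.mem_iUnion.2 ⟨(g : G ⧸ N), ((g : G ⧸ N).out⁻¹ * g) • x, ⟨⟨_, ?_⟩, rfl⟩, ?_⟩
  · rw [← QuotientGroup.eq]
    exact QuotientGroup.out_eq' _
  · simp only [smul_smul, mul_inv_cancel_left]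

theorem infinite_range_of_not_hasFiniteOrbit {X : Type*} [TopologicalSpace X]
    {Γ : Subgroup (X ≃ₜ X)} (h : ¬ HasFiniteOrbit Γ) (N : Subgroup Γ) [N.FiniteIndex] (x : X) :
    (Set.range fun n : N => ((n : Γ) : X ≃ₜ X) x).Infinite := by
  let _ : MulAction Γ X :=
    { smul := fun g y => (g : X ≃ₜ X) y
      one_smul := fun _ => rfl
      mul_smul := fun _ _ _ => rfl }
  exact fun hfin => h ⟨x, finite_orbit_of_finiteIndex N hfin⟩

/-- As `F` may jump, a level `s` need not be attained; this supremum is a generalized inverse of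
`F`, defined for every `s` and still equivariant. -/
theorem sSup_le_fiber_map (F : CircleDeg1Lift) (u : CircleDeg1Liftˣ) {c : ℝ}
    (h : ∀ t, F (u t) = F t + c) (s : ℝ) :
    u (sSup {t | F t ≤ s}) = sSup {t | F t ≤ s + c} := by
  have hne : {t | F t ≤ s}.Nonempty :=
    (F.tendsto_atBot.eventually (Filter.eventually_le_atBot s)).exists
  have hbdd : BddAbove {t | F t ≤ s} := by
    obtain ⟨b, hb⟩ := (F.tendsto_atTop.eventually (Filter.eventually_gt_atTop s)).exists
    refine ⟨b, fun t ht => ?_⟩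
    by_contra hlt
    exact absurd (F.monotone (not_le.1 hlt).le) (not_le.2 (lt_of_le_of_lt ht hb))
  have h1 := (toOrderIso u).map_csSup' hne hbdd
  rw [coe_toOrderIso] at h1
  rw [h1]
  congr 1
  ext t
  constructor
  · rintro ⟨r, hr, rfl⟩
    change F (u r) ≤ s + c
    rw [h]
    exact add_le_add_left hr c
  · intro ht
    refine ⟨(u⁻¹ : CircleDeg1Liftˣ) t, ?_, units_apply_inv_apply u t⟩
    have h2 := h ((u⁻¹ : CircleDeg1Liftˣ) t)
    rw [units_apply_inv_apply] at h2
    have ht' : F t ≤ s + c := ht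
    change F _ ≤ s
    linarith

theorem sSup_le_fiber_add_int (F : CircleDeg1Lift) (s : ℝ) (n : ℤ) :
    sSup {t | F t ≤ s + n} = sSup {t | F t ≤ s} + n := by
  have h := sSup_le_fiber_map F (translate (Multiplicative.ofAdd (n : ℝ))) (c := n)
    (fun t => by rw [translate_apply, add_comm, F.map_add_int]) s
  rw [← h, translate_apply, add_comm]

/-! ### Rational translation numbers give a finite orbit, an irrational one gives continuity. -/

section Semiconj

variable {Γ : Subgroup (UnitAddCircle ≃ₜ UnitAddCircle)} {F : CircleDeg1Lift}

/-- The orbit of the generalized inverse of `F` at `0` consists of its values at multiples of `1 /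
q`, and modulo integers there are only `q` of these. -/
theorem hasFiniteOrbit_of_translationNumber (hΓ : Γ ≤ circleDiff)
    (hF : ∀ (u : CircleDeg1Liftˣ) (g : UnitAddCircle ≃ₜ UnitAddCircle), g ∈ Γ →
      IsLift u g → ∀ t, F (u t) = F t + translationNumber u) {q : ℕ} (hq : 0 < q)
    (h : ∀ (u : CircleDeg1Liftˣ) (g : UnitAddCircle ≃ₜ UnitAddCircle), g ∈ Γ →
      IsLift u g → ∃ k : ℤ, q * translationNumber u = k) : HasFiniteOrbit Γ := by
  refine ⟨(sSup {t | F t ≤ 0} : ℝ), ((Finset.range q).finite_toSet.image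
    fun r : ℕ => ((sSup {t | F t ≤ (r : ℝ) / q} : ℝ) : UnitAddCircle)).subset ?_⟩
  rintro _ ⟨g, rfl⟩
  obtain ⟨u, hu, -⟩ := exists_units_isLift (hΓ g.2)
  obtain ⟨k, hk⟩ := h u g g.2 hu
  have hq0 : (q : ℝ) ≠ 0 := by exact_mod_cast hq.ne'
  have hqz : (q : ℤ) ≠ 0 := by exact_mod_cast hq.ne'
  have h0 := Int.emod_nonneg k hqz
  have h1 := Int.emod_lt_of_pos k (b := q) (by exact_mod_cast hq)
  refine ⟨(k % q).toNat, ?_, ?_⟩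
  · rw [Finset.mem_coe, Finset.mem_range]
    omega
  · have e : (0 : ℝ) + translationNumber u = ((k % q).toNat : ℝ) / q + ((k / q : ℤ) : ℝ) := by
      have h2 : (((k % q).toNat : ℤ) : ℝ) = ((k % q : ℤ) : ℝ) := by rw [Int.toNat_of_nonneg h0]
      have h3 : ((k % q : ℤ) : ℝ) + q * ((k / q : ℤ) : ℝ) = k := by
        exact_mod_cast Int.emod_add_mul_ediv k q
      rw [Int.cast_natCast] at h2
      field_simp
      linarith
    change _ = (g : UnitAddCircle ≃ₜ UnitAddCircle) ((sSup {t | F t ≤ 0} : ℝ) : UnitAddCircle)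
    rw [← hu.2, sSup_le_fiber_map F u (hF u g g.2 hu), e, sSup_le_fiber_add_int]
    exact (UnitAddCircle.coe_eq_coe_iff.2 ⟨_, rfl⟩).symm

/-- The semiconjugacy makes translation numbers additive, and changing the lift changes them by an
integer. The condition thus passes from generators to products and inverses. -/
theorem exists_int_eq_mul_translationNumber {𝒢 : Set (UnitAddCircle ≃ₜ UnitAddCircle)}
    (h𝒢 : Subgroup.closure 𝒢 = Γ) (hΓ : Γ ≤ circleDiff)
    (hF : ∀ (u : CircleDeg1Liftˣ) (g : UnitAddCircle ≃ₜ UnitAddCircle), g ∈ Γ →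
      IsLift u g → ∀ t, F (u t) = F t + translationNumber u) {q : ℕ}
    (h : ∀ g ∈ 𝒢, ∃ u : CircleDeg1Liftˣ, IsLift u g ∧ ∃ k : ℤ, q * translationNumber u = k)
    (u : CircleDeg1Liftˣ) (g : UnitAddCircle ≃ₜ UnitAddCircle) (hg : g ∈ Γ) (hu : IsLift u g) :
    ∃ k : ℤ, q * translationNumber u = k := by
  have heq : ∀ (v w : CircleDeg1Liftˣ) (g : UnitAddCircle ≃ₜ UnitAddCircle), g ∈ Γ →
      IsLift v g → IsLift w g → (∃ k : ℤ, q * translationNumber v = k) →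
      ∃ k : ℤ, q * translationNumber w = k := by
    rintro v w g hg hv hw ⟨k, hk⟩
    obtain ⟨n, hn⟩ := UnitAddCircle.coe_eq_coe_iff.1 ((hw.2 0).trans (hv.2 0).symm)
    have h1 := hF w g hg hw 0
    rw [hn, F.map_add_int, hF v g hg hv 0] at h1
    refine ⟨k + q * n, ?_⟩
    push_cast
    rw [← hk, ← mul_add]
    congr 1
    linarith
  rw [← h𝒢] at hg
  induction hg using Subgroup.closure_induction generalizing u with
  | mem g hg =>
    obtain ⟨v, hv, hk⟩ := h g hg
    exact heq v u g (h𝒢 ▸ Subgroup.subset_closure hg) hv hu hk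
  | one =>
    refine heq 1 u 1 (one_mem _) ⟨continuous_id, fun _ => rfl⟩ hu ⟨0, ?_⟩
    simp
  | mul a b ha hb iha ihb =>
    rw [h𝒢] at ha hb
    obtain ⟨v, hv, -⟩ := exists_units_isLift (hΓ ha)
    obtain ⟨w, hw, -⟩ := exists_units_isLift (hΓ hb)
    obtain ⟨k, hk⟩ := iha v hv
    obtain ⟨l, hl⟩ := ihb w hw
    have hvw : IsLift (v * w : CircleDeg1Liftˣ) (a * b : UnitAddCircle ≃ₜ UnitAddCircle) :=
      hv.comp hw
    refine heq (v * w) u (a * b) (mul_mem ha hb) hvw hu ⟨k + l, ?_⟩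
    have h1 := hF (v * w) _ (mul_mem ha hb) hvw 0
    have h2 : F ((v * w : CircleDeg1Liftˣ) 0) = F (v (w 0)) := rfl
    rw [h2, hF v a ha hv, hF w b hb hw] at h1
    push_cast
    rw [← hk, ← hl, ← mul_add]
    congr 1
    rw [Units.val_mul] at h1
    linarith
  | inv a ha iha =>
    rw [h𝒢] at ha
    obtain ⟨k, hk⟩ := iha u⁻¹ hu.inv
    refine ⟨-k, ?_⟩
    rw [translationNumber_units_inv] at hk
    push_cast
    linarith

/-- The range of `F` contains all `F 0 + k * τ + n` with `k ≥ 0` and `n` an integer, where `τ` is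
the translation number of `u`. It is therefore dense, and a monotone function with dense range is
continuous, so `F` descends to the circle. -/
theorem semiconjToRotations_of_irrational (hΓ : Γ ≤ circleDiff)
    (hF : ∀ (u : CircleDeg1Liftˣ) (g : UnitAddCircle ≃ₜ UnitAddCircle), g ∈ Γ →
      IsLift u g → ∀ t, F (u t) = F t + translationNumber u)
    {u : CircleDeg1Liftˣ} {g : UnitAddCircle ≃ₜ UnitAddCircle} (hg : g ∈ Γ) (hu : IsLift u g)
    (hτ : Irrational (translationNumber u)) : SemiconjToRotations Γ := by
  have hcont : Continuous F := by
    refine F.monotone.continuous_of_denseRange (Metric.denseRange_iff.2 fun a ε hε => ?_)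
    obtain ⟨K, hK⟩ := hτ.exists_forall_exists_abs_mul_sub_le (half_pos hε)
    obtain ⟨k, -, n, hn⟩ := hK (a - F 0)
    refine ⟨(u : CircleDeg1Lift)^[k] 0 + ((-n : ℤ) : ℝ), ?_⟩
    rw [F.map_add_int, semiconj_iterate (hF u g hg hu), dist_comm, Real.dist_eq]
    push_cast
    refine lt_of_le_of_lt ?_ (half_lt_self hε)
    rwa [show F 0 + k * translationNumber u + -n - a =
      k * translationNumber u - n - (a - F 0) by ring]
  have hper : Function.Periodic (fun t : ℝ => ((F t : ℝ) : UnitAddCircle)) 1 := fun t => by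
    simp only [F.map_add_one, UnitAddCircle.coe_add_one]
  set h : UnitAddCircle → UnitAddCircle := hper.lift with hh
  have hlift : IsLift F h := ⟨hcont, fun _ => rfl⟩
  have hex : ∀ f : Γ, ∃ r : UnitAddCircle, ∀ x, h ((f : UnitAddCircle ≃ₜ UnitAddCircle) x) =
      h x + r := by
    intro f
    obtain ⟨v, hv, -⟩ := exists_units_isLift (hΓ f.2)
    refine ⟨(translationNumber v : ℝ), fun x => ?_⟩
    obtain ⟨t, rfl⟩ := QuotientAddGroup.mk_surjective x
    rw [← hv.2, ← hlift.2, ← hlift.2, hF v f f.2 hv, AddCircle.coe_add]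
  choose ρ hρ using hex
  refine ⟨MonoidHom.mk' (fun f => Multiplicative.ofAdd (ρ f)) fun f g => ?_, h, F, hlift,
    F.monotone, F.map_add_one, fun f x => hρ f x⟩
  have h1 := hρ (f * g) 0
  have h2 : h (((f * g : Γ) : UnitAddCircle ≃ₜ UnitAddCircle) 0) = h 0 + ρ g + ρ f := by
    rw [← hρ g, ← hρ f]
    rfl
  rw [h2, add_assoc] at h1
  rw [← ofAdd_add, ← add_left_cancel h1, add_comm]

end Semiconj

/-! ### Assembly of the two alternatives. -/

theorem semiconjToRotations_of_not_hasFiniteOrbit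
    {Γ : Subgroup (UnitAddCircle ≃ₜ UnitAddCircle)} {𝒢 : Set (UnitAddCircle ≃ₜ UnitAddCircle)}
    (hΓ : Γ ≤ circleDiff) (hfin : 𝒢.Finite) (h𝒢 : Subgroup.closure 𝒢 = Γ)
    (hnil : Group.IsVirtuallyNilpotent Γ) (hno : ¬ HasFiniteOrbit Γ) :
    SemiconjToRotations Γ := by
  obtain ⟨F, hF⟩ := exists_semiconj_translationNumber hnil
  have hsub : 𝒢 ⊆ Γ := h𝒢 ▸ Subgroup.subset_closure
  by_cases hirr : ∃ g ∈ 𝒢, ∃ u : CircleDeg1Liftˣ, IsLift u g ∧ Irrational (translationNumber u)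
  · obtain ⟨g, hg, u, hu, hτ⟩ := hirr
    exact semiconjToRotations_of_irrational hΓ hF (hsub hg) hu hτ
  · exfalso
    push Not at hirr
    have hrat : ∀ g : UnitAddCircle ≃ₜ UnitAddCircle, ∃ r : ℚ, g ∈ 𝒢 →
        ∃ u : CircleDeg1Liftˣ, IsLift u g ∧ (r : ℝ) = translationNumber u := by
      intro g
      by_cases hg : g ∈ 𝒢
      · obtain ⟨u, hu, -⟩ := exists_units_isLift (hΓ (hsub hg))
        have h1 := hirr g hg u hu
        rw [Irrational, not_not] at h1
        obtain ⟨r, hr⟩ := h1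
        exact ⟨r, fun _ => ⟨u, hu, hr⟩⟩
      · exact ⟨0, fun h => absurd h hg⟩
    choose r hr using hrat
    -- Finite generation provides a common denominator `q`.
    refine hno (hasFiniteOrbit_of_translationNumber hΓ hF
      (q := ∏ g ∈ hfin.toFinset, (r g).den) (Finset.prod_pos fun g _ => (r g).den_pos)
      (exists_int_eq_mul_translationNumber h𝒢 hΓ hF fun g hg => ?_))
    obtain ⟨u, hu, he⟩ := hr g hg
    obtain ⟨d, hd⟩ := Finset.dvd_prod_of_mem (fun g => (r g).den) (hfin.mem_toFinset.2 hg)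
    refine ⟨u, hu, d * (r g).num, ?_⟩
    have h1 : ((r g).den : ℝ) * (r g : ℝ) = (r g).num := by exact_mod_cast Rat.den_mul_eq_num (r g)
    rw [hd, ← he]
    push_cast
    rw [← h1]
    ring

theorem exists_abs_sub_log_circleDeriv_le
    {Γ : Subgroup (UnitAddCircle ≃ₜ UnitAddCircle)} {S : Set (UnitAddCircle ≃ₜ UnitAddCircle)}
    (hΓ : Γ ≤ circleDiff) (hfin : S.Finite) (hS : S ⊆ Γ)
    (hnil : Group.IsVirtuallyNilpotent Γ) (hno : ¬ HasFiniteOrbit Γ) {ε : ℝ} (hε : 0 < ε) :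
    ∃ u : C(UnitAddCircle, ℝ), ∀ f ∈ S, ∀ x : UnitAddCircle,
      |u x - u (f x) - Real.log (circleDeriv f x)| ≤ ε := by
  obtain ⟨N, hN, hNi⟩ := hnil
  obtain ⟨u, hu⟩ := (logDerivCocycle.comap (Subgroup.inclusion hΓ)).exists_twist_le_of_finiteIndex
    N (hasSublinearPowers_logDerivCocycle ((Subgroup.inclusion hΓ).comp N.subtype)
      (infinite_range_of_not_hasFiniteOrbit hno N))
    (hfin.preimage (f := ((↑) : Γ → UnitAddCircle ≃ₜ UnitAddCircle))
      Subtype.val_injective.injOn).toFinset hε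
  refine ⟨u, fun f hf x => ?_⟩
  have h1 := hu ⟨f, hS hf⟩ (by simpa using hf)
  have h2 := (ContinuousMap.norm_le _ hε.le).1 h1 x
  -- The twisted cocycle is `log Df + u ∘ f - u`, the negative of the required expression.
  rw [← abs_neg]
  refine le_of_eq_of_le (congrArg abs ?_) h2
  change _ = Real.log (circleDeriv f x) + u (f x) - u x
  ring

theorem StrictMono.map_unitInterval_zero {f : unitInterval ≃ₜ unitInterval} (hf : StrictMono f) :
    f 0 = 0 := by
  refine le_antisymm ?_ unitInterval.nonneg'
  calc f 0 ≤ f (f.symm 0) := hf.monotone unitInterval.nonneg'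
    _ = 0 := f.apply_symm_apply 0

theorem mainTheorem6 :
    (∀ (Γ : Subgroup (unitInterval ≃ₜ unitInterval)) (𝒢 : Set (unitInterval ≃ₜ unitInterval)),
      Γ ≤ intervalDiff → 𝒢.Finite → Subgroup.closure 𝒢 = Γ → Group.IsVirtuallyNilpotent Γ →
        HasFiniteOrbit Γ) ∧
    (∀ (Γ : Subgroup (UnitAddCircle ≃ₜ UnitAddCircle)) (𝒢 : Set (UnitAddCircle ≃ₜ UnitAddCircle)),
      Γ ≤ circleDiff → 𝒢.Finite → Subgroup.closure 𝒢 = Γ → Group.IsVirtuallyNilpotent Γ →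
        HasFiniteOrbit Γ ∨
        (¬ HasFiniteOrbit Γ ∧ SemiconjToRotations Γ ∧
          ∀ ε : ℝ, 0 < ε → ∃ u : C(UnitAddCircle, ℝ), ∀ f ∈ 𝒢, ∀ x : UnitAddCircle,
            |u x - u (f x) - Real.log (circleDeriv f x)| ≤ ε)) := by
  -- On the interval, the orbit of the endpoint `0` is a single point.
  refine ⟨fun Γ 𝒢 hΓ _ _ _ => ⟨0, (Set.finite_singleton 0).subset ?_⟩,
    fun Γ 𝒢 hΓ hfin h𝒢 hnil => or_iff_not_imp_left.2 fun hno => ⟨hno,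
      semiconjToRotations_of_not_hasFiniteOrbit hΓ hfin h𝒢 hnil hno, fun ε hε =>
      exists_abs_sub_log_circleDeriv_le hΓ hfin (h𝒢 ▸ Subgroup.subset_closure) hnil hno hε⟩⟩
  rintro _ ⟨f, rfl⟩
  exact (hΓ f.2).1.map_unitInterval_zero
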